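/- Let $M_k$ denote the complex $k\times k$ matrices with inner product $\langle C,D\rangle=\mathrm{tr}(CD^*)$, and identify $M_k\otimes M_m$ with $M_{km}$ via the Kronecker product. **Definitions.** A *Hermitian Schmidt decomposition* of $A\in M_k\otimes M_m$ is a decomposition $A=\sum_{i=1}^n\lambda_i\,\gamma_i\otimes\delta_i$ with all $\lambda_i>0$ and with $\gamma_1,\dots,\gamma_n\in M_k$ and $\delta_1,\dots,\delta_n\in M_m$ orthonormal families of Hermitian matrices. A positive semidefinite Hermitian $A\in M_k\otimes M_k$ is *SPC* if it has a Hermitian Schmidt decomposition with $\gamma_i=\delta_i$ for all $i$; a positive semidefinite Hermitian $A\in M_k\otimes M_m$ is *PPT* if its partial transpose $A^{t_1}=((\cdot)^t\otimes \mathrm{Id})(A)$ is also positive semidefinite. A positive semidefinite Hermitian $A\in M_k\otimes M_m$ is *weak irreducible* if for all Hermitian projections $V_1,V_2\in M_k$ and $W_1,W_2\in M_m$ with $V_1V_2=0$, $W_1W_2=0$, $V_1+V_2=\mathrm{Id}$, $W_1+W_2=\mathrm{Id}$, the equality $A=\sum_{i=1}^2(V_i\otimes W_i)A(V_i\otimes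 W_i)$ implies $(V_1\otimes W_1)A(V_1\otimes W_1)=0$ or $(V_2\otimes W_2)A(V_2\otimes W_2)=0$. *Split decomposition of a nonzero PPT matrix $A$.* Take a Hermitian Schmidt decomposition $A=\sum_{i=1}^n\lambda_i\gamma_i\otimes\delta_i$ with $\lambda_1=\dots=\lambda_s>\lambda_{s+1}\ge\dots\ge\lambda_n$, and a Hermitian Schmidt decomposition $\sum_{i=1}^s\gamma_i\otimes\delta_i=\sum_{i=1}^s\gamma_i'\otimes\delta_i'$ with all $\gamma_i',\delta_i'$ positive semidefinite. For $i\le s$ let $V_i$, $W_i$ be the Hermitian projections onto the images of $\gamma_i'$, $\delta_i'$, and let $V_{s+1}$, $W_{s+1}$ be the Hermitian projections onto the orthogonal complements of $\sum_{i\le s}\Im(\gamma_i')$ and $\sum_{i\le s}\Im(\delta_i')$. The terms of the split decomposition are $(V_i\otimes W_i)A(V_i\otimes W_i)$, $1\le i\le s+1$. For a nonzero SPC matrix the same construction is made with $\gamma_i=\delta_i$, $\gamma'_i=\delta'_i$, hence $V_i=W_i$. *Iterated split decomposition.* Its pieces form a list: the empty list if $A=0$; otherwise the first $s$ terms of a split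 decomposition of $A$, followed by the pieces of an iterated split decomposition of the last term $(V_{s+1}\otimes W_{s+1})A(V_{s+1}\otimes W_{s+1})$. **Statement.** Every SPC (respectively PPT) matrix $A$ has an iterated split decomposition. For every iterated split decomposition of $A$, with pieces $A_1,\dots,A_r$, one has $A=A_1+\dots+A_r$, each $A_j$ is nonzero, SPC (respectively PPT) and weak irreducible, and either $A$ itself is weak irreducible or $r\ge2$ (or both). In particular, every SPC (respectively PPT) matrix is weak irreducible or a sum of weak irreducible SPC (respectively PPT) matrices, namely the pieces of its iterated split decomposition. -/

import Mathlib

open scoped Kronecker ComplexOrder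

/-- `M_k`: complex `k × k` matrices. -/
abbrev CMat (k : ℕ) : Type := Matrix (Fin k) (Fin k) ℂ

/-- `M_k ⊗ M_m`, identified with `M_{km}` through the Kronecker product `⊗ₖ`. -/
abbrev BiMat (k m : ℕ) : Type := Matrix (Fin k × Fin m) (Fin k × Fin m) ℂ

/-- `A = ∑ i, lam i • (γ i ⊗ δ i)` is a Hermitian Schmidt decomposition of `A`: the coefficients are
positive, and `γ`, `δ` are families of Hermitian matrices that are orthonormal for the inner product
`⟨C, D⟩ = tr (C D*)`. -/
structure IsHermitianSchmidt {k m n : ℕ} (A : BiMat k m) (lam : Fin n → ℝ)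
    (γ : Fin n → CMat k) (δ : Fin n → CMat m) : Prop where
  pos : ∀ i, 0 < lam i
  herm_left : ∀ i, (γ i).IsHermitian
  herm_right : ∀ i, (δ i).IsHermitian
  orthonormal_left : ∀ i j, (γ i * (γ j).conjTranspose).trace = if i = j then 1 else 0
  orthonormal_right : ∀ i j, (δ i * (δ j).conjTranspose).trace = if i = j then 1 else 0
  eq_sum : A = ∑ i, (lam i : ℂ) • (γ i ⊗ₖ δ i)

/-- SPC (symmetric with positive coefficients) matrices: positive semidefinite Hermitian, with a
Hermitian Schmidt decomposition of the form `∑ i, lam i • (γ i ⊗ γ i)`. -/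
def IsSPC {k : ℕ} (A : BiMat k k) : Prop :=
  A.PosSemidef ∧ ∃ (n : ℕ) (lam : Fin n → ℝ) (γ : Fin n → CMat k), IsHermitianSchmidt A lam γ γ

/-- The partial transposition `(·)ᵗ ⊗ Id`. -/
def partialTranspose {k m : ℕ} (A : BiMat k m) : BiMat k m :=
  Matrix.of fun p q => A (q.1, p.2) (p.1, q.2)

theorem partialTranspose_kronecker {k m : ℕ} (X : CMat k) (Y : CMat m) :
    partialTranspose (X ⊗ₖ Y) = X.transpose ⊗ₖ Y := by
  ext p q
  simp [partialTranspose, Matrix.kroneckerMap_apply]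

/-- PPT (positive under partial transposition) matrices. -/
def IsPPT {k m : ℕ} (A : BiMat k m) : Prop :=
  A.PosSemidef ∧ (partialTranspose A).PosSemidef

/-- The compression `(V ⊗ W) A (V ⊗ W)`. -/
def compress {k m : ℕ} (V : CMat k) (W : CMat m) (A : BiMat k m) : BiMat k m :=
  (V ⊗ₖ W) * A * (V ⊗ₖ W)

/-- Weak irreducible matrices. -/
def IsWeakIrreducible {k m : ℕ} (A : BiMat k m) : Prop :=
  A.PosSemidef ∧
    ∀ (V₁ V₂ : CMat k) (W₁ W₂ : CMat m),
      IsStarProjection V₁ → IsStarProjection V₂ → IsStarProjection W₁ → IsStarProjection W₂ →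
      V₁ * V₂ = 0 → W₁ * W₂ = 0 → V₁ + V₂ = 1 → W₁ + W₂ = 1 →
      A = compress V₁ W₁ A + compress V₂ W₂ A →
      compress V₁ W₁ A = 0 ∨ compress V₂ W₂ A = 0

/-- The image of a matrix, as a subspace of `ℂ^k` with its standard Hermitian inner product. -/
noncomputable def matImage {k : ℕ} (γ : CMat k) : Submodule ℂ (EuclideanSpace ℂ (Fin k)) :=
  LinearMap.range (Matrix.toEuclideanLin γ)

/-- The matrix of the orthogonal (Hermitian) projection of `ℂ^k` onto the subspace `S`. -/
noncomputable def orthProj {k : ℕ} (S : Submodule ℂ (EuclideanSpace ℂ (Fin k))) : CMat k :=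
  Matrix.toEuclideanLin.symm (S.starProjection : EuclideanSpace ℂ (Fin k) →ₗ[ℂ] _)

/-- The Hermitian projection onto the orthogonal complement of the sum of the images of the `γ i`. -/
noncomputable def complProj {k s : ℕ} (γ : Fin s → CMat k) : CMat k :=
  orthProj (⨆ i, matImage (γ i))ᗮ

/-- The data from which a split decomposition of `A` is formed. One starts from a Hermitian Schmidt
decomposition `A = ∑ i, lam i • (γ i ⊗ δ i)` whose coefficients are in decreasing order, the largest
one being repeated exactly `s ≥ 1` times; then `D = ∑ i < s, γ i ⊗ δ i` is written as a Hermitian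
Schmidt decomposition `D = ∑ i, γ' i ⊗ δ' i` with all `γ' i`, `δ' i` positive semidefinite. -/
structure IsSplitData {k m n s : ℕ} (A : BiMat k m) (lam : Fin n → ℝ)
    (γ : Fin n → CMat k) (δ : Fin n → CMat m)
    (γ' : Fin s → CMat k) (δ' : Fin s → CMat m) : Prop where
  schmidt : IsHermitianSchmidt A lam γ δ
  antitone : Antitone lam
  one_le : 1 ≤ s
  le : s ≤ n
  top_eq : ∀ i j : Fin n, (i : ℕ) < s → (j : ℕ) < s → lam i = lam j
  top_gt : ∀ i j : Fin n, (i : ℕ) < s → s ≤ (j : ℕ) → lam j < lam i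
  schmidt_top : IsHermitianSchmidt (∑ i ∈ Finset.univ.filter (fun i : Fin n => (i : ℕ) < s), γ i ⊗ₖ δ i)
    (fun _ : Fin s => (1 : ℝ)) γ' δ'
  posSemidef_left : ∀ i, (γ' i).PosSemidef
  posSemidef_right : ∀ i, (δ' i).PosSemidef

/-- The `i`-th piece `(V_i ⊗ W_i) A (V_i ⊗ W_i)`, `i ≤ s`, of the split decomposition of `A`, where
`V_i`, `W_i` are the Hermitian projections onto the images of `γ' i` and `δ' i`. -/
noncomputable def splitPiece {k m s : ℕ} (A : BiMat k m)
    (γ' : Fin s → CMat k) (δ' : Fin s → CMat m) (i : Fin s) : BiMat k m :=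
  compress (orthProj (matImage (γ' i))) (orthProj (matImage (δ' i))) A

/-- The last term `(V_{s+1} ⊗ W_{s+1}) A (V_{s+1} ⊗ W_{s+1})` of the split decomposition of `A`. -/
noncomputable def splitRemainder {k m s : ℕ} (A : BiMat k m)
    (γ' : Fin s → CMat k) (δ' : Fin s → CMat m) : BiMat k m :=
  compress (complProj γ') (complProj δ') A

/-- `IteratedSplitSPC A L`: `L` is the list of pieces of an iterated split decomposition of the
matrix `A` in the SPC setting (the same matrices in both tensor factors): take the first `s` terms
of the split decomposition of `A`, and continue with its last term as long as that is nonzero. -/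
inductive IteratedSplitSPC {k : ℕ} : BiMat k k → List (BiMat k k) → Prop
  | zero : IteratedSplitSPC 0 []
  | step {n s : ℕ} {A : BiMat k k} {lam : Fin n → ℝ} {γ : Fin n → CMat k} {γ' : Fin s → CMat k}
      {L : List (BiMat k k)} (h : IsSplitData A lam γ γ γ' γ')
      (hL : IteratedSplitSPC (splitRemainder A γ' γ') L) :
      IteratedSplitSPC A (List.ofFn (splitPiece A γ' γ') ++ L)

/-- `IteratedSplitPPT A L`: `L` is the list of pieces of an iterated split decomposition of the
matrix `A` in the PPT setting: take the first `s` terms of the split decomposition of `A`, and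
continue with its last term as long as that is nonzero. -/
inductive IteratedSplitPPT {k m : ℕ} : BiMat k m → List (BiMat k m) → Prop
  | zero : IteratedSplitPPT 0 []
  | step {n s : ℕ} {A : BiMat k m} {lam : Fin n → ℝ} {γ : Fin n → CMat k} {δ : Fin n → CMat m}
      {γ' : Fin s → CMat k} {δ' : Fin s → CMat m}
      {L : List (BiMat k m)} (h : IsSplitData A lam γ δ γ' δ')
      (hL : IteratedSplitPPT (splitRemainder A γ' δ') L) :
      IteratedSplitPPT A (List.ofFn (splitPiece A γ' δ') ++ L)

/-!
View `A` as a linear map between the real inner product spaces of Hermitian matrices: the left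
contraction sends `X` to `∑ λᵢ ⟨γᵢ, X⟩ δᵢ`, so a Hermitian Schmidt decomposition of `A` is a
singular value decomposition of this map, and the left contraction preserves positive
semidefiniteness when `A` is positive semidefinite.

The decisive property, shared by SPC and PPT matrices, is that whenever `X`, `Y` are positive
semidefinite and form a pair of singular vectors with positive singular value, `A` is block diagonal
along the support projections of `X` and `Y`. For PPT matrices this holds because the mixed blocks
`(V ⊗ (1 - W)) A (V ⊗ (1 - W))` vanish, and their partial transposes with them; for SPC matrices the
map is positive semidefinite, which forces `X = Y`, and the vanishing mixed block is
`∑ λᵢ N ⊗ Nᴴ` with `N = V γᵢ (1 - V)`, so every `N` is zero.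

The left contraction stretches `P - N` at most as much as `P + N` when `P`, `N` are positive
semidefinite with `P N = 0`; hence the singular space of the largest singular value contains the
positive and negative parts of its elements, and by the block structure it is stable under
multiplication by their support projections. Such a space has an orthonormal basis of positive
semidefinite matrices with orthogonal supports. Splitting `A` along these supports gives the split
decomposition: the top singular space of each of the first `s` pieces is one-dimensional, so no
piece splits further, and the remainder has a strictly larger kernel, so the iteration stops.
-/

open Matrix in
theorem eq_zero_of_sum_smul_kronecker_conjTranspose_eq_zero {ι κ : Type*} [Fintype κ]
    {lam : κ → ℝ} {N : κ → Matrix ι ι ℂ} (hlam : ∀ i, 0 < lam i)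
    (h : ∑ i, (lam i : ℂ) • (N i ⊗ₖ (N i)ᴴ) = 0) (i : κ) : N i = 0 := by
  ext p q
  -- The entry of the sum at `((p, q), (q, p))` is `∑ λᵢ |Nᵢ p q|²`.
  have hsum : ∑ i, lam i * Complex.normSq (N i p q) = 0 := by
    have hpq := congrFun (congrFun h (p, q)) (q, p)
    simp only [Matrix.sum_apply, Matrix.smul_apply, kroneckerMap_apply, conjTranspose_apply,
      smul_eq_mul, Complex.star_def, Complex.mul_conj, Matrix.zero_apply] at hpq
    exact_mod_cast hpq
  have hi := (Finset.sum_eq_zero_iff_of_nonneg fun i _ =>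
    mul_nonneg (hlam i).le (Complex.normSq_nonneg _)).mp hsum i (Finset.mem_univ i)
  exact Complex.normSq_eq_zero.mp ((mul_eq_zero.mp hi).resolve_left (hlam i).ne')

section PositiveSemidefinite

open Matrix

variable {ι : Type*} [Fintype ι] {A B V : Matrix ι ι ℂ}

theorem exists_eq_conjTranspose_mul_self (hA : A.PosSemidef) : ∃ C : Matrix ι ι ℂ, A = Cᴴ * C := by
  classical
  open scoped MatrixOrder in
  exact CStarAlgebra.nonneg_iff_eq_star_mul_self.mp hA.nonneg

theorem trace_conjTranspose_mul_self_mul (C D : Matrix ι ι ℂ) :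
    ((Cᴴ * C) * (Dᴴ * D)).trace = ((D * Cᴴ)ᴴ * (D * Cᴴ)).trace := by
  rw [conjTranspose_mul, conjTranspose_conjTranspose, ← Matrix.mul_assoc,
    Matrix.trace_mul_comm _ D, Matrix.trace_mul_comm (C * Dᴴ)]
  simp only [Matrix.mul_assoc]

theorem trace_mul_nonneg_of_posSemidef (hA : A.PosSemidef) (hB : B.PosSemidef) :
    0 ≤ (A * B).trace := by
  obtain ⟨C, rfl⟩ := exists_eq_conjTranspose_mul_self hA
  obtain ⟨D, rfl⟩ := exists_eq_conjTranspose_mul_self hB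
  rw [trace_conjTranspose_mul_self_mul]
  exact (posSemidef_conjTranspose_mul_self _).trace_nonneg

theorem mul_eq_zero_of_trace_mul_eq_zero (hA : A.PosSemidef) (hB : B.PosSemidef)
    (h : (A * B).trace = 0) : A * B = 0 := by
  obtain ⟨C, rfl⟩ := exists_eq_conjTranspose_mul_self hA
  obtain ⟨D, rfl⟩ := exists_eq_conjTranspose_mul_self hB
  rw [trace_conjTranspose_mul_self_mul, trace_conjTranspose_mul_self_eq_zero_iff] at h
  have hCD : C * Dᴴ = 0 := by simpa using congrArg conjTranspose h
  rw [Matrix.mul_assoc, ← Matrix.mul_assoc C, hCD, Matrix.zero_mul, Matrix.mul_zero]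

theorem exists_posSemidef_sub_posSemidef (hA : A.IsHermitian) :
    ∃ P N : Matrix ι ι ℂ, P.PosSemidef ∧ N.PosSemidef ∧ A = P - N ∧ P * N = 0 := by
  classical
  open scoped MatrixOrder in
  exact ⟨A⁺, A⁻, nonneg_iff_posSemidef.mp (CFC.posPart_nonneg A),
    nonneg_iff_posSemidef.mp (CFC.negPart_nonneg A), (CFC.posPart_sub_negPart A hA).symm,
    CFC.posPart_mul_negPart A⟩

theorem mul_eq_zero_comm_of_isHermitian (hA : A.IsHermitian) (hB : B.IsHermitian)
    (h : A * B = 0) : B * A = 0 := by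
  simpa [hA.eq, hB.eq] using congrArg conjTranspose h

theorem posSemidef_of_isStarProjection (hV : IsStarProjection V) : V.PosSemidef := by
  open scoped MatrixOrder in
  exact nonneg_iff_posSemidef.mp hV.nonneg

end PositiveSemidefinite

section Support

open Matrix

variable {k : ℕ} {S : Submodule ℂ (EuclideanSpace ℂ (Fin k))} {X Y : CMat k}

theorem toEuclideanLin_orthProj (S : Submodule ℂ (EuclideanSpace ℂ (Fin k))) :
    toEuclideanLin (orthProj S) = S.starProjection := by
  rw [orthProj, LinearEquiv.apply_symm_apply]

theorem orthProj_eq_toEuclideanCLM_symm (S : Submodule ℂ (EuclideanSpace ℂ (Fin k))) :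
    orthProj S = (toEuclideanCLM (n := Fin k) (𝕜 := ℂ)).symm S.starProjection := by
  rw [orthProj, LinearEquiv.symm_apply_eq, ← coe_toEuclideanCLM_eq_toEuclideanLin,
    StarAlgEquiv.apply_symm_apply]

theorem isStarProjection_orthProj (S : Submodule ℂ (EuclideanSpace ℂ (Fin k))) :
    IsStarProjection (orthProj S) := by
  rw [orthProj_eq_toEuclideanCLM_symm]
  have hS := isStarProjection_starProjection (U := S)
  set e := (toEuclideanCLM (n := Fin k) (𝕜 := ℂ)).symm
  exact ⟨hS.1.map e, (map_star e _).symm.trans (congrArg e hS.2)⟩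

theorem orthProj_orthogonal (S : Submodule ℂ (EuclideanSpace ℂ (Fin k))) :
    orthProj Sᗮ = 1 - orthProj S := by
  simp only [orthProj_eq_toEuclideanCLM_symm, Submodule.starProjection_orthogonal', map_sub,
    map_one]

theorem orthProj_mul_of_matImage_le (h : matImage X ≤ S) : orthProj S * X = X := by
  apply toEuclideanLin.injective
  rw [toLpLin_mul_same, toEuclideanLin_orthProj]
  ext1 v
  exact Submodule.starProjection_eq_self_iff.mpr (h (LinearMap.mem_range_self _ v))

theorem mul_orthProj_eq_zero_of_le_ker (h : S ≤ LinearMap.ker (toEuclideanLin Y)) :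
    Y * orthProj S = 0 := by
  apply toEuclideanLin.injective
  rw [toLpLin_mul_same, toEuclideanLin_orthProj, map_zero]
  ext1 v
  exact LinearMap.mem_ker.mp (h (Submodule.starProjection_apply_mem S v))

/-- The support of `X`: the Hermitian projection onto its image, which is what the projections
`V_i`, `W_i` of a split decomposition are. -/
noncomputable def supp (X : CMat k) : CMat k := orthProj (matImage X)

theorem isStarProjection_supp (X : CMat k) : IsStarProjection (supp X) :=
  isStarProjection_orthProj _

theorem isHermitian_supp (X : CMat k) : (supp X).IsHermitian := (isStarProjection_supp X).2

theorem supp_mul (X : CMat k) : supp X * X = X := orthProj_mul_of_matImage_le le_rfl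

theorem mul_supp (hX : X.IsHermitian) : X * supp X = X := by
  simpa [hX.eq, (isHermitian_supp X).eq] using congrArg conjTranspose (supp_mul X)

theorem exists_mul_eq_supp (X : CMat k) : ∃ Z : CMat k, X * Z = supp X := by
  have hrange : LinearMap.range (toEuclideanLin (supp X)) ≤ LinearMap.range (toEuclideanLin X) := by
    rw [supp, toEuclideanLin_orthProj]
    exact (Submodule.range_starProjection _).le
  obtain ⟨f, hf⟩ := Module.projective_lifting_property (toEuclideanLin X).rangeRestrict
    ((toEuclideanLin (supp X)).codRestrict _ fun v => hrange ⟨v, rfl⟩)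
    (LinearMap.surjective_rangeRestrict _)
  refine ⟨toEuclideanLin.symm f, toEuclideanLin.injective ?_⟩
  rw [toLpLin_mul_same, LinearEquiv.apply_symm_apply]
  ext1 v
  exact congrArg Subtype.val (LinearMap.congr_fun hf v)

theorem mul_supp_eq_zero (h : Y * X = 0) : Y * supp X = 0 := by
  obtain ⟨Z, hZ⟩ := exists_mul_eq_supp X
  rw [← hZ, ← Matrix.mul_assoc, h, Matrix.zero_mul]

theorem supp_mul_eq_zero (hX : X.IsHermitian) (h : X * Y = 0) : supp X * Y = 0 := by
  have h' : Yᴴ * X = 0 := by simpa [hX.eq] using congrArg conjTranspose h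
  simpa [(isHermitian_supp X).eq] using congrArg conjTranspose (mul_supp_eq_zero h')

variable {s : ℕ} {γ : Fin s → CMat k}

theorem isStarProjection_complProj (γ : Fin s → CMat k) : IsStarProjection (complProj γ) :=
  isStarProjection_orthProj _

theorem complProj_add_sum_supp (hγ : ∀ i, (γ i).IsHermitian)
    (h : Pairwise fun i j => γ i * γ j = 0) : complProj γ + ∑ i, supp (γ i) = 1 := by
  set P := orthProj (⨆ i, matImage (γ i))
  have hP : P.IsHermitian := (isStarProjection_orthProj _).2
  have hPsupp : ∀ i, P * supp (γ i) = supp (γ i) := fun i => by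
    obtain ⟨Z, hZ⟩ := exists_mul_eq_supp (γ i)
    rw [← hZ, ← Matrix.mul_assoc, orthProj_mul_of_matImage_le (le_iSup (matImage <| γ ·) i)]
  have hsum_mul : (∑ i, supp (γ i)) * P = ∑ i, supp (γ i) := by
    rw [Finset.sum_mul]
    exact Finset.sum_congr rfl fun i _ => by
      simpa [hP.eq, (isHermitian_supp _).eq] using congrArg conjTranspose (hPsupp i)
  have hsum_fix : ∀ j, (1 - ∑ i, supp (γ i)) * γ j = 0 := fun j => by
    rw [sub_mul, one_mul, Finset.sum_mul,
      Finset.sum_eq_single j (fun i _ hij => supp_mul_eq_zero (hγ i) (h hij)) (by simp), supp_mul,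
      sub_self]
  have hcompl : (1 - ∑ i, supp (γ i)) * P = 0 :=
    mul_orthProj_eq_zero_of_le_ker <| iSup_le fun j => LinearMap.range_le_ker_iff.mpr <| by
      rw [← toLpLin_mul_same, hsum_fix, map_zero]
  rw [sub_mul, one_mul, hsum_mul, sub_eq_zero] at hcompl
  rw [complProj, orthProj_orthogonal, ← hcompl, sub_add_cancel]

end Support

section SingularValues

open Module LinearMap
open scoped InnerProductSpace

variable {𝕜 E F : Type*} [RCLike 𝕜] [NormedAddCommGroup E] [InnerProductSpace 𝕜 E]
  [NormedAddCommGroup F] [InnerProductSpace 𝕜 F]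

theorem norm_sum_smul_sq_of_orthonormal {ι : Type*} [Fintype ι] {v : ι → E}
    (hv : Orthonormal 𝕜 v) (c : ι → 𝕜) : ‖∑ i, c i • v i‖ ^ 2 = ∑ i, ‖c i‖ ^ 2 := by
  rw [← inner_self_eq_norm_sq (𝕜 := 𝕜), hv.inner_sum, map_sum]
  exact Finset.sum_congr rfl fun i _ => by
    rw [RCLike.conj_mul, ← RCLike.ofReal_pow, RCLike.ofReal_re]

theorem sum_inner_smul_eq_starProjection {ι : Type*} [Fintype ι] {u : ι → E} {K : Submodule 𝕜 E}
    [K.HasOrthogonalProjection] (hu : Orthonormal 𝕜 u) (hK : Submodule.span 𝕜 (Set.range u) = K)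
    (x : E) : ∑ i, ⟪u i, x⟫_𝕜 • u i = K.starProjection x := by
  subst hK
  refine (Submodule.eq_starProjection_of_mem_of_inner_eq_zero (Submodule.sum_mem _ fun i _ =>
    Submodule.smul_mem _ _ (Submodule.subset_span (Set.mem_range_self i))) fun w hw => ?_).symm
  induction hw using Submodule.span_induction with
  | mem _ h =>
    obtain ⟨j, rfl⟩ := h
    rw [inner_sub_left, hu.inner_left_fintype, inner_conj_symm, sub_self]
  | zero => exact inner_zero_right _
  | add _ _ _ _ h₁ h₂ => rw [inner_add_right, h₁, h₂, add_zero]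
  | smul c _ _ h => rw [inner_smul_right, h, mul_zero]

theorem norm_sum_mul_inner_smul_le {ι : Type*} [Fintype ι] {u : ι → E} {v : ι → F}
    (hu : Orthonormal 𝕜 u) (hv : Orthonormal 𝕜 v) {σ : ι → ℝ} {l : ℝ} (hσ : ∀ i, |σ i| ≤ l)
    (hl : 0 ≤ l) (x : E) : ‖∑ i, ((σ i : 𝕜) * ⟪u i, x⟫_𝕜) • v i‖ ≤ l * ‖x‖ := by
  refine le_of_sq_le_sq ?_ (by positivity)
  rw [norm_sum_smul_sq_of_orthonormal hv, mul_pow]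
  calc ∑ i, ‖(σ i : 𝕜) * ⟪u i, x⟫_𝕜‖ ^ 2
      ≤ ∑ i, l ^ 2 * ‖⟪u i, x⟫_𝕜‖ ^ 2 := by
        refine Finset.sum_le_sum fun i _ => ?_
        rw [norm_mul, mul_pow, RCLike.norm_ofReal]
        gcongr
        exact hσ i
    _ ≤ l ^ 2 * ‖x‖ ^ 2 := by
        rw [← Finset.mul_sum]
        gcongr
        exact hu.sum_inner_products_le x

theorem eq_sq_smul_of_norm_le_mul {x z : E} {l r : ℝ} (hl : 0 ≤ l)
    (hzx : RCLike.re ⟪z, x⟫_𝕜 = r ^ 2) (hz : ‖z‖ ≤ l * r) (hx : l * ‖x‖ ≤ r) :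
    z = ((l : 𝕜) ^ 2) • x := by
  have hinner : RCLike.re ⟪z, ((l : 𝕜) ^ 2) • x⟫_𝕜 = l ^ 2 * r ^ 2 := by
    rw [inner_smul_right, ← RCLike.ofReal_pow, RCLike.re_ofReal_mul, hzx]
  have hnorm : ‖((l : 𝕜) ^ 2) • x‖ = l * (l * ‖x‖) := by
    rw [norm_smul, norm_pow, RCLike.norm_ofReal, sq_abs, sq, mul_assoc]
  -- Expanding the square, `‖z - l² x‖² ≤ l² r² - 2 l² r² + l² r²`.
  have hsq : ‖z - ((l : 𝕜) ^ 2) • x‖ ^ 2 ≤ 0 := by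
    rw [@norm_sub_sq 𝕜, hinner, hnorm]
    have hz' := pow_le_pow_left₀ (norm_nonneg z) hz 2
    have hx' : (l * (l * ‖x‖)) ^ 2 ≤ (l * r) ^ 2 := by gcongr
    linarith [mul_pow l r 2]
  exact sub_eq_zero.mp (norm_eq_zero.mp (pow_eq_zero_iff two_ne_zero |>.mp
    (le_antisymm hsq (sq_nonneg _))))

theorem inner_apply_apply_eigenvectorBasis_adjoint_comp_self [FiniteDimensional 𝕜 E]
    [FiniteDimensional 𝕜 F] (T : E →ₗ[𝕜] F) (i j : Fin (finrank 𝕜 E)) :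
    ⟪T (T.isSymmetric_adjoint_comp_self.eigenvectorBasis rfl i),
      T (T.isSymmetric_adjoint_comp_self.eigenvectorBasis rfl j)⟫_𝕜 =
        if i = j then (T.singularValues i : 𝕜) ^ 2 else 0 := by
  have hj := T.isSymmetric_adjoint_comp_self.apply_eigenvectorBasis rfl j
  rw [← T.sq_singularValues_fin rfl] at hj
  rw [← LinearMap.adjoint_inner_right, ← LinearMap.comp_apply, hj, inner_smul_right,
    OrthonormalBasis.inner_eq_ite]
  split_ifs with h <;> simp [h]

theorem exists_singularValueDecomposition [FiniteDimensional 𝕜 E] [FiniteDimensional 𝕜 F]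
    (T : E →ₗ[𝕜] F) :
    ∃ (n : ℕ) (σ : Fin n → ℝ) (u : Fin n → E) (v : Fin n → F), (∀ i, 0 < σ i) ∧ Orthonormal 𝕜 u ∧
      Orthonormal 𝕜 v ∧ ∀ x, T x = ∑ i, ((σ i : 𝕜) * ⟪u i, x⟫_𝕜) • v i := by
  let b := T.isSymmetric_adjoint_comp_self.eigenvectorBasis rfl
  have hinner : ∀ i j, ⟪T (b i), T (b j)⟫_𝕜 = if i = j then (T.singularValues i : 𝕜) ^ 2 else 0 :=
    inner_apply_apply_eigenvectorBasis_adjoint_comp_self T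
  let e := Fin.castLE T.finrank_range_le
  have he : Function.Injective e := Fin.castLE_injective _
  let σ : Fin (finrank 𝕜 T.range) → ℝ := fun i => T.singularValues i
  have hσ : ∀ i, 0 < σ i := fun i => T.singularValues_pos_iff_lt_finrank_range.mpr i.2
  have hσ' : ∀ i, (σ i : 𝕜) ≠ 0 := fun i => RCLike.ofReal_ne_zero.mpr (hσ i).ne'
  refine ⟨_, σ, fun i => b (e i), fun i => (σ i : 𝕜)⁻¹ • T (b (e i)), hσ,
    b.orthonormal.comp _ he, ?_, fun x => ?_⟩
  · refine orthonormal_iff_ite.mpr fun i j => ?_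
    have hi : (T.singularValues (e i) : 𝕜) = σ i := rfl
    simp only [inner_smul_left, inner_smul_right, hinner, he.eq_iff, map_inv₀, RCLike.conj_ofReal,
      hi]
    split_ifs with h
    · subst h
      have := hσ' i
      field_simp
    · rw [mul_zero, mul_zero]
  · have hker : ∀ j, j ∉ Set.range e → ⟪b j, x⟫_𝕜 • T (b j) = 0 := fun j hj => by
      have hj' : T.singularValues j = 0 :=
        T.singularValues_eq_zero_iff_le_finrank_range.mpr (by simpa [e] using hj)
      have hTb : T (b j) = 0 := by
        rw [← inner_self_eq_zero (𝕜 := 𝕜), hinner, if_pos rfl, hj', RCLike.ofReal_zero,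
          zero_pow two_ne_zero]
      rw [hTb, smul_zero]
    calc T x = ∑ j, ⟪b j, x⟫_𝕜 • T (b j) := by
          conv_lhs => rw [← b.sum_repr' x, map_sum]
          simp only [map_smul]
      _ = ∑ i, ⟪b (e i), x⟫_𝕜 • T (b (e i)) :=
          (Fintype.sum_of_injective e he _ _ hker fun _ => rfl).symm
      _ = _ := Finset.sum_congr rfl fun i _ => by
          rw [smul_smul, mul_right_comm, mul_inv_cancel₀ (hσ' i), one_mul]

theorem eq_of_apply_eq_smul_of_nonneg {T : E →ₗ[𝕜] E} (hT : ∀ x, 0 ≤ RCLike.re ⟪T x, x⟫_𝕜) {l : ℝ}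
    (hl : 0 < l) {x y : E} (hxy : T x = (l : 𝕜) • y) (hyx : T y = (l : 𝕜) • x) : x = y := by
  have hsub : T (x - y) = (-l : 𝕜) • (x - y) := by
    rw [map_sub, hxy, hyx]
    module
  have hnonneg := hT (x - y)
  rw [hsub, inner_smul_left, inner_self_eq_norm_sq_to_K, map_neg, RCLike.conj_ofReal] at hnonneg
  norm_cast at hnonneg
  have : ‖x - y‖ ^ 2 ≤ 0 := by nlinarith
  exact sub_eq_zero.mp (norm_eq_zero.mp (pow_eq_zero_iff two_ne_zero |>.mp
    (le_antisymm this (sq_nonneg _))))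

theorem exists_orthonormal_decomposition_of_isPositive [FiniteDimensional 𝕜 E] {T : E →ₗ[𝕜] E}
    (hT : T.IsPositive) :
    ∃ (n : ℕ) (σ : Fin n → ℝ) (u : Fin n → E), (∀ i, 0 < σ i) ∧ Orthonormal 𝕜 u ∧
      ∀ x, T x = ∑ i, ((σ i : 𝕜) * ⟪u i, x⟫_𝕜) • u i := by
  obtain ⟨n, σ, u, v, hσ, hu, hv, hTx⟩ := exists_singularValueDecomposition T
  have hTu : ∀ i, T (u i) = (σ i : 𝕜) • v i := fun i => by
    simp [hTx, orthonormal_iff_ite.mp hu, ite_smul]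
  have hTv : ∀ i, T (v i) = (σ i : 𝕜) • u i := fun i => by
    refine ext_inner_right 𝕜 fun x => ?_
    rw [hT.isSymmetric, hTx, hv.inner_right_fintype, inner_smul_left, RCLike.conj_ofReal]
  have huv : u = v := funext fun i => eq_of_apply_eq_smul_of_nonneg hT.2 (hσ i) (hTu i) (hTv i)
  exact ⟨n, σ, u, hσ, hu, huv ▸ hTx⟩

theorem exists_orthonormal_sum_mul_inner_smul_eq [FiniteDimensional 𝕜 E] {ι : Type*} [Fintype ι]
    {c : ι → ℝ} (hc : ∀ i, 0 ≤ c i) (x : ι → E) :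
    ∃ (n : ℕ) (σ : Fin n → ℝ) (u : Fin n → E), (∀ j, 0 < σ j) ∧ Orthonormal 𝕜 u ∧
      ∀ y, ∑ i, ((c i : 𝕜) * ⟪x i, y⟫_𝕜) • x i = ∑ j, ((σ j : 𝕜) * ⟪u j, y⟫_𝕜) • u j := by
  have hT : (∑ i, (c i : 𝕜) •
      (InnerProductSpace.rankOne 𝕜 (x i) (x i) : E →ₗ[𝕜] E)).IsPositive :=
    LinearMap.isPositive_sum _ fun i _ =>
      (InnerProductSpace.isPositive_rankOne_self (x i)).toLinearMap.smul_of_nonneg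
        (RCLike.ofReal_nonneg.mpr (hc i))
  simpa [smul_smul] using exists_orthonormal_decomposition_of_isPositive hT

end SingularValues

namespace TraceInnerProduct

variable {ι : Type*} [Fintype ι]

/-- The real inner product `re tr (X Yᴴ)` on complex matrices. On Hermitian matrices it agrees with
the complex inner product `tr (X Yᴴ)`, for which they do not form a complex subspace. -/
@[reducible] noncomputable def innerCore : InnerProductSpace.Core ℝ (Matrix ι ι ℂ) where
  inner X Y := (X * Y.conjTranspose).trace.re
  conj_inner_symm X Y := by
    rw [RCLike.conj_to_real, ← Complex.conj_re, ← Complex.star_def, ← Matrix.trace_conjTranspose,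
      Matrix.conjTranspose_mul, Matrix.conjTranspose_conjTranspose]
  re_inner_nonneg X :=
    (Complex.nonneg_iff.mp (Matrix.posSemidef_self_mul_conjTranspose X).trace_nonneg).1
  add_left X Y Z := by rw [add_mul, Matrix.trace_add, Complex.add_re]
  smul_left X Y r := by simp
  definite X hX := by
    refine Matrix.trace_mul_conjTranspose_self_eq_zero_iff.mp (Complex.ext hX ?_)
    exact (Complex.nonneg_iff.mp (Matrix.posSemidef_self_mul_conjTranspose X).trace_nonneg).2.symm

noncomputable scoped instance : NormedAddCommGroup (Matrix ι ι ℂ) := innerCore.toNormedAddCommGroup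

noncomputable scoped instance : InnerProductSpace ℝ (Matrix ι ι ℂ) := .ofCore innerCore.toCore

theorem inner_eq_re_trace (X Y : Matrix ι ι ℂ) :
    inner ℝ X Y = (X * Y.conjTranspose).trace.re := rfl

end TraceInnerProduct

section HermitianInner

open Matrix
open scoped TraceInnerProduct

variable {ι κ : Type*} [Fintype ι] {X Y : Matrix ι ι ℂ}

theorem ofReal_inner_eq_trace_mul (hX : X.IsHermitian) (hY : Y.IsHermitian) :
    (inner ℝ X Y : ℂ) = (X * Y).trace := by
  rw [TraceInnerProduct.inner_eq_re_trace, hY.eq, ← Complex.conj_eq_iff_re, ← Complex.star_def,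
    ← trace_conjTranspose, conjTranspose_mul, hX.eq, hY.eq, trace_mul_comm]

theorem orthonormal_iff_trace_mul_conjTranspose [DecidableEq κ] {γ : κ → Matrix ι ι ℂ}
    (hγ : ∀ i, (γ i).IsHermitian) :
    Orthonormal ℝ γ ↔ ∀ i j, (γ i * (γ j).conjTranspose).trace = if i = j then 1 else 0 := by
  refine orthonormal_iff_ite.trans (forall₂_congr fun i j => ?_)
  rw [(hγ j).eq, ← ofReal_inner_eq_trace_mul (hγ i) (hγ j)]
  split_ifs <;> norm_cast

theorem inner_nonneg_of_posSemidef (hX : X.PosSemidef) (hY : Y.PosSemidef) : 0 ≤ inner ℝ X Y := by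
  have := trace_mul_nonneg_of_posSemidef hX hY
  rw [← ofReal_inner_eq_trace_mul hX.1 hY.1] at this
  exact_mod_cast this

theorem mul_eq_zero_of_inner_eq_zero (hX : X.PosSemidef) (hY : Y.PosSemidef)
    (h : inner ℝ X Y = 0) : X * Y = 0 :=
  mul_eq_zero_of_trace_mul_eq_zero hX hY <| by
    rw [← ofReal_inner_eq_trace_mul hX.1 hY.1, h, Complex.ofReal_zero]

theorem inner_eq_zero_of_mul_eq_zero (hY : Y.IsHermitian) (h : X * Y = 0) : inner ℝ X Y = 0 := by
  rw [TraceInnerProduct.inner_eq_re_trace, hY.eq, h, trace_zero, Complex.zero_re]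

end HermitianInner

section Contraction

open Matrix

variable {ι κ R : Type*} [CommRing R]

/-- The contraction `tr₁ ((X ⊗ 1) A)` of the first tensor factor of `A` against `X`. It sends
`C ⊗ D` to the linear map `X ↦ tr (C X) D`, so that a Hermitian Schmidt decomposition of `A` is a
singular value decomposition of its contraction. -/
def leftContraction [Fintype ι] :
    Matrix (ι × κ) (ι × κ) R →ₗ[R] Matrix ι ι R →ₗ[R] Matrix κ κ R :=
  LinearMap.mk₂ R
    (fun A X => of fun b b' => ∑ a, ∑ a', A (a, b) (a', b') * X a' a)
    (fun A A' X => by ext; simp [add_mul, Finset.sum_add_distrib])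
    (fun c A X => by ext; simp [mul_assoc, Finset.mul_sum])
    (fun A X X' => by ext; simp [mul_add, Finset.sum_add_distrib])
    (fun c A X => by ext; simp [mul_left_comm, Finset.mul_sum])

/-- The flip `C ⊗ D ↦ D ⊗ C` of the two tensor factors. -/
def swapFactors (A : Matrix (ι × κ) (ι × κ) R) : Matrix (κ × ι) (κ × ι) R :=
  A.submatrix Prod.swap Prod.swap

/-- The contraction of the second tensor factor of `A`: it sends `C ⊗ D` to `Y ↦ tr (D Y) C`. For
Hermitian `A` it is the adjoint of `leftContraction A` with respect to the trace inner products. -/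
def rightContraction [Fintype κ] (A : Matrix (ι × κ) (ι × κ) R) : Matrix κ κ R →ₗ[R] Matrix ι ι R :=
  leftContraction (swapFactors A)

theorem leftContraction_apply_apply [Fintype ι] (A : Matrix (ι × κ) (ι × κ) R) (X : Matrix ι ι R)
    (b b' : κ) : leftContraction A X b b' = ∑ a, ∑ a', A (a, b) (a', b') * X a' a := rfl

theorem swapFactors_kronecker (C : Matrix ι ι R) (D : Matrix κ κ R) :
    swapFactors (C ⊗ₖ D) = D ⊗ₖ C := by
  ext
  exact mul_comm _ _

theorem swapFactors_mul [Fintype ι] [Fintype κ] (A B : Matrix (ι × κ) (ι × κ) R) :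
    swapFactors (A * B) = swapFactors A * swapFactors B :=
  (submatrix_mul_equiv A B _ (Equiv.prodComm κ ι) _).symm

variable [Fintype ι]

theorem leftContraction_kronecker (C X : Matrix ι ι R) (D : Matrix κ κ R) :
    leftContraction (C ⊗ₖ D) X = (C * X).trace • D := by
  ext b b'
  simp only [leftContraction_apply_apply, kroneckerMap_apply, Matrix.smul_apply, smul_eq_mul, trace,
    diag, mul_apply, Finset.sum_mul]
  exact Finset.sum_congr rfl fun a _ => Finset.sum_congr rfl fun a' _ => mul_right_comm _ _ _

theorem leftContraction_injective : Function.Injective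
    (leftContraction : Matrix (ι × κ) (ι × κ) R →ₗ[R] Matrix ι ι R →ₗ[R] Matrix κ κ R) := by
  classical
  refine (injective_iff_map_eq_zero _).mpr fun A hA => ?_
  ext ⟨a, b⟩ ⟨a', b'⟩
  simpa [leftContraction_apply_apply, single_apply, ite_and] using
    congrFun (congrFun (LinearMap.congr_fun hA (single a' a 1)) b) b'

variable [Fintype κ]

theorem trace_mul_kronecker (A : Matrix (ι × κ) (ι × κ) R) (X : Matrix ι ι R) (Y : Matrix κ κ R) :
    (A * (X ⊗ₖ Y)).trace = (leftContraction A X * Y).trace := by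
  simp only [trace, diag, mul_apply, kroneckerMap_apply, Fintype.sum_prod_type,
    leftContraction_apply_apply, Finset.sum_mul]
  rw [Finset.sum_comm]
  refine Finset.sum_congr rfl fun b _ => ?_
  conv_lhs => enter [2, a]; rw [Finset.sum_comm]
  rw [Finset.sum_comm]
  exact Finset.sum_congr rfl fun b' _ => Finset.sum_congr rfl fun a _ =>
    Finset.sum_congr rfl fun a' _ => (mul_assoc _ _ _).symm

theorem trace_swapFactors (A : Matrix (ι × κ) (ι × κ) R) : (swapFactors A).trace = A.trace :=
  Fintype.sum_equiv (Equiv.prodComm κ ι) _ _ fun _ => rfl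

theorem trace_rightContraction_mul (A : Matrix (ι × κ) (ι × κ) R) (X : Matrix ι ι R)
    (Y : Matrix κ κ R) : (rightContraction A Y * X).trace = (leftContraction A X * Y).trace := by
  rw [rightContraction, ← trace_mul_kronecker, ← trace_mul_kronecker, ← trace_swapFactors,
    swapFactors_mul, swapFactors_kronecker]
  rfl

theorem leftContraction_mul_kronecker (A : Matrix (ι × κ) (ι × κ) R) (V X : Matrix ι ι R)
    (W : Matrix κ κ R) : leftContraction (A * (V ⊗ₖ W)) X = leftContraction A (V * X) * W := by
  refine ext_iff_trace_mul_right.mpr fun Y => ?_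
  rw [← trace_mul_kronecker, mul_assoc, ← mul_kronecker_mul, trace_mul_kronecker, mul_assoc]

theorem leftContraction_kronecker_mul (A : Matrix (ι × κ) (ι × κ) R) (V X : Matrix ι ι R)
    (W : Matrix κ κ R) : leftContraction ((V ⊗ₖ W) * A) X = W * leftContraction A (X * V) := by
  refine ext_iff_trace_mul_right.mpr fun Y => ?_
  rw [← trace_mul_kronecker, mul_assoc, trace_mul_comm, mul_assoc, ← mul_kronecker_mul,
    trace_mul_kronecker, mul_assoc, ← mul_assoc, trace_mul_comm]

end Contraction

section HermitianContraction

open Matrix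

variable {ι κ : Type*} {A B : Matrix (ι × κ) (ι × κ) ℂ}

theorem conjTranspose_leftContraction [Fintype ι] (A : Matrix (ι × κ) (ι × κ) ℂ)
    (X : Matrix ι ι ℂ) : (leftContraction A X)ᴴ = leftContraction Aᴴ Xᴴ := by
  ext b b'
  simp only [conjTranspose_apply, leftContraction_apply_apply, star_sum, star_mul']
  exact Finset.sum_comm

theorem isHermitian_leftContraction [Fintype ι] (hA : A.IsHermitian) {X : Matrix ι ι ℂ}
    (hX : X.IsHermitian) : (leftContraction A X).IsHermitian := by
  rw [IsHermitian, conjTranspose_leftContraction, hA.eq, hX.eq]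

variable [Fintype ι]

theorem eq_of_leftContraction_eq_of_isHermitian
    (h : ∀ X : Matrix ι ι ℂ, X.IsHermitian → leftContraction A X = leftContraction B X) :
    A = B := by
  refine leftContraction_injective (LinearMap.ext fun X => ?_)
  rw [← realPart_add_I_smul_imaginaryPart X]
  simp only [map_add, map_smul]
  rw [h _ (realPart X).2, h _ (imaginaryPart X).2]

theorem posSemidef_leftContraction [Finite κ] (hA : A.PosSemidef) {X : Matrix ι ι ℂ}
    (hX : X.PosSemidef) : (leftContraction A X).PosSemidef := by
  cases nonempty_fintype κ
  refine PosSemidef.of_dotProduct_mulVec_nonneg (isHermitian_leftContraction hA.1 hX.1) fun v => ?_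
  have h := trace_mul_nonneg_of_posSemidef hA (hX.kronecker (posSemidef_vecMulVec_self_star v))
  rwa [trace_mul_kronecker, mul_vecMulVec, trace_vecMulVec, dotProduct_comm] at h

open scoped TraceInnerProduct in
theorem inner_rightContraction [Fintype κ] (hA : A.IsHermitian) {X : Matrix ι ι ℂ}
    (hX : X.IsHermitian) (Y : Matrix κ κ ℂ) :
    inner ℝ (rightContraction A Y) X = inner ℝ Y (leftContraction A X) := by
  rw [TraceInnerProduct.inner_eq_re_trace, TraceInnerProduct.inner_eq_re_trace, hX.eq,
    trace_rightContraction_mul, (isHermitian_leftContraction hA hX).eq, trace_mul_comm]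

end HermitianContraction

section SplitsAlong

open Matrix

variable {ι κ R : Type*} [Fintype ι] [Fintype κ] [DecidableEq ι] [DecidableEq κ] [CommRing R]
  {A : Matrix (ι × κ) (ι × κ) R} {V V' : Matrix ι ι R} {W W' : Matrix κ κ R}

/-- `A` is block diagonal along the pair of idempotents `V`, `W`: it commutes with `V ⊗ 1` and
`1 ⊗ W`, which act on it in the same way. For Hermitian projections this says
`A = (V ⊗ W) A (V ⊗ W) + ((1 - V) ⊗ (1 - W)) A ((1 - V) ⊗ (1 - W))`. -/
structure SplitsAlong (A : Matrix (ι × κ) (ι × κ) R) (V : Matrix ι ι R) (W : Matrix κ κ R) :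
    Prop where
  commute_left : Commute (V ⊗ₖ 1) A
  commute_right : Commute (1 ⊗ₖ W) A
  mul_eq_mul : A * (V ⊗ₖ 1) = A * (1 ⊗ₖ W)

namespace SplitsAlong

theorem one_one : SplitsAlong A 1 1 := by
  constructor <;> simp only [one_kronecker_one, Commute.one_left]

theorem zero_zero : SplitsAlong A 0 0 := by
  constructor <;> simp only [zero_kronecker, kronecker_zero, Commute.zero_left]

theorem add (h : SplitsAlong A V W) (h' : SplitsAlong A V' W') :
    SplitsAlong A (V + V') (W + W') where
  commute_left := add_kronecker V V' (1 : Matrix κ κ R) ▸ h.commute_left.add_left h'.commute_left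
  commute_right := kronecker_add (1 : Matrix ι ι R) W W' ▸ h.commute_right.add_left h'.commute_right
  mul_eq_mul := by
    rw [add_kronecker, kronecker_add, mul_add, mul_add, h.mul_eq_mul, h'.mul_eq_mul]

theorem neg (h : SplitsAlong A V W) : SplitsAlong A (-V) (-W) := by
  have hV : (-V) ⊗ₖ (1 : Matrix κ κ R) = -(V ⊗ₖ 1) := by ext; simp [kroneckerMap_apply]
  have hW : (1 : Matrix ι ι R) ⊗ₖ (-W) = -(1 ⊗ₖ W) := by ext; simp [kroneckerMap_apply]
  refine ⟨hV ▸ h.commute_left.neg_left, hW ▸ h.commute_right.neg_left, ?_⟩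
  rw [hV, hW, mul_neg, mul_neg, h.mul_eq_mul]

theorem sum {σ : Type*} (s : Finset σ) {V : σ → Matrix ι ι R} {W : σ → Matrix κ κ R}
    (h : ∀ i ∈ s, SplitsAlong A (V i) (W i)) : SplitsAlong A (∑ i ∈ s, V i) (∑ i ∈ s, W i) := by
  classical
  induction s using Finset.induction_on with
  | empty => exact zero_zero
  | insert i s hi ih =>
    rw [Finset.sum_insert hi, Finset.sum_insert hi]
    exact (h i (s.mem_insert_self i)).add (ih fun j hj => h j (Finset.mem_insert_of_mem hj))

protected theorem swapFactors (h : SplitsAlong A V W) : SplitsAlong (swapFactors A) W V := by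
  refine ⟨?_, ?_, ?_⟩
  · simpa only [commute_iff_eq, swapFactors_mul, swapFactors_kronecker] using
      congrArg swapFactors h.commute_right.eq
  · simpa only [commute_iff_eq, swapFactors_mul, swapFactors_kronecker] using
      congrArg swapFactors h.commute_left.eq
  · simpa only [swapFactors_mul, swapFactors_kronecker] using
      congrArg swapFactors h.mul_eq_mul.symm

theorem mul_kronecker_one (hVV' : Commute V V') (h' : SplitsAlong A V' W') :
    SplitsAlong (A * (V ⊗ₖ 1)) V' W' := by
  have hcomm : Commute (V' ⊗ₖ (1 : Matrix κ κ R)) (V ⊗ₖ 1) := by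
    rw [commute_iff_eq, ← mul_kronecker_mul, ← mul_kronecker_mul, hVV'.eq]
  have hcomm' : Commute ((1 : Matrix ι ι R) ⊗ₖ W') (V ⊗ₖ 1) := by
    rw [commute_iff_eq, ← mul_kronecker_mul, ← mul_kronecker_mul]
    simp only [mul_one, one_mul]
  refine ⟨h'.commute_left.mul_right hcomm, h'.commute_right.mul_right hcomm', ?_⟩
  rw [mul_assoc, mul_assoc, ← hcomm.eq, ← hcomm'.eq, ← mul_assoc, ← mul_assoc, h'.mul_eq_mul]

theorem leftContraction_mul_left (h : SplitsAlong A V W) (X : Matrix ι ι R) :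
    leftContraction A (V * X) = W * leftContraction A X := by
  have h' := congrArg (leftContraction · X) (h.mul_eq_mul.trans h.commute_right.eq.symm)
  simpa only [leftContraction_mul_kronecker, leftContraction_kronecker_mul, mul_one] using h'

theorem commute_leftContraction (h : SplitsAlong A V W) (X : Matrix ι ι R) :
    Commute W (leftContraction A X) := by
  rw [commute_iff_eq]
  have h' := congrArg (leftContraction · X) h.commute_right.eq
  simpa only [leftContraction_mul_kronecker, leftContraction_kronecker_mul, mul_one, one_mul]
    using h'

end SplitsAlong

end SplitsAlong

section Compression

open Matrix

variable {k m : ℕ} {A : BiMat k m} {V V₁ V₂ : CMat k} {W W₁ W₂ : CMat m}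

theorem SplitsAlong.compress_eq (h : SplitsAlong A V W) (hV : IsIdempotentElem V)
    (hW : IsIdempotentElem W) : compress V W A = A * (V ⊗ₖ 1) := by
  have hVW : V ⊗ₖ W = (V ⊗ₖ 1) * (1 ⊗ₖ W) := by rw [← mul_kronecker_mul, mul_one, one_mul]
  have hcomm : Commute (V ⊗ₖ W) A := hVW ▸ h.commute_left.mul_left h.commute_right
  calc compress V W A = A * ((V ⊗ₖ W) * (V ⊗ₖ W)) := by
        rw [compress, hcomm.eq, mul_assoc]
    _ = A * (V ⊗ₖ 1) * (1 ⊗ₖ W) := by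
        rw [← mul_kronecker_mul, hV.eq, hW.eq, hVW, mul_assoc]
    _ = A * (V ⊗ₖ 1) := by
        rw [h.mul_eq_mul, mul_assoc, ← mul_kronecker_mul, mul_one, hW.eq]

theorem splitsAlong_of_eq_compress_add_compress (hV₁ : IsStarProjection V₁)
    (hV₂ : IsStarProjection V₂) (hW₁ : IsStarProjection W₁) (hW₂ : IsStarProjection W₂)
    (hV : V₁ * V₂ = 0) (hW : W₁ * W₂ = 0) (hA : A = compress V₁ W₁ A + compress V₂ W₂ A) :
    SplitsAlong A V₁ W₁ := by
  have hV' : V₂ * V₁ = 0 := mul_eq_zero_comm_of_isHermitian hV₁.2 hV₂.2 hV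
  have hW' : W₂ * W₁ = 0 := mul_eq_zero_comm_of_isHermitian hW₁.2 hW₂.2 hW
  set C := compress V₁ W₁ A with hC
  have hleft : (V₁ ⊗ₖ 1) * A = C ∧ (1 ⊗ₖ W₁) * A = C := by
    constructor <;> conv_lhs => rw [hA]
    all_goals
      simp only [hC, compress, mul_add, ← mul_assoc, ← mul_kronecker_mul, one_mul, hV, hW, hV₁.1.eq,
        hW₁.1.eq, zero_kronecker, kronecker_zero, zero_mul, add_zero]
  have hright : A * (V₁ ⊗ₖ 1) = C ∧ A * (1 ⊗ₖ W₁) = C := by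
    constructor <;> conv_lhs => rw [hA]
    all_goals
      simp only [hC, compress, add_mul, mul_assoc, ← mul_kronecker_mul, mul_one, hV', hW',
        hV₁.1.eq, hW₁.1.eq, zero_kronecker, kronecker_zero, mul_zero, add_zero]
  exact ⟨hleft.1.trans hright.1.symm, hleft.2.trans hright.2.symm, hright.1.trans hright.2.symm⟩

end Compression

section SingularPairs

open Matrix

theorem mul_kronecker_one_eq_mul_one_kronecker {ι κ R : Type*} [Fintype ι] [Fintype κ]
    [DecidableEq ι] [DecidableEq κ] [CommRing R] {A : Matrix (ι × κ) (ι × κ) R} {V : Matrix ι ι R}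
    {W : Matrix κ κ R} (h₁ : A * (V ⊗ₖ (1 - W)) = 0) (h₂ : A * ((1 - V) ⊗ₖ W) = 0) :
    A * (V ⊗ₖ 1) = A * (1 ⊗ₖ W) :=
  calc A * (V ⊗ₖ 1) = A * (V ⊗ₖ (1 - W)) + A * (V ⊗ₖ W) := by
        rw [← mul_add, ← kronecker_add, sub_add_cancel]
    _ = A * ((1 - V) ⊗ₖ W) + A * (V ⊗ₖ W) := by rw [h₁, h₂]
    _ = A * (1 ⊗ₖ W) := by rw [← mul_add, ← add_kronecker, sub_add_cancel]

variable {k m : ℕ} {A : BiMat k m} {X : CMat k} {Y Z : CMat m}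

theorem mul_supp_kronecker_eq_zero (hA : A.PosSemidef) (hX : X.PosSemidef) (hZ : Z.PosSemidef)
    (h : leftContraction A X * Z = 0) : A * (supp X ⊗ₖ Z) = 0 := by
  have hXZ : A * (X ⊗ₖ Z) = 0 := mul_eq_zero_of_trace_mul_eq_zero hA (hX.kronecker hZ) <| by
    rw [trace_mul_kronecker, h, trace_zero]
  obtain ⟨T, hT⟩ := exists_mul_eq_supp X
  rw [← hT, ← mul_one Z, mul_kronecker_mul, ← mul_assoc, hXZ, zero_mul]

theorem mul_kronecker_supp_eq_zero {Z : CMat k} (hA : A.PosSemidef) (hY : Y.PosSemidef)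
    (hZ : Z.PosSemidef) (h : rightContraction A Y * Z = 0) : A * (Z ⊗ₖ supp Y) = 0 := by
  have := congrArg swapFactors (mul_supp_kronecker_eq_zero (hA.submatrix Prod.swap) hY hZ h)
  rwa [swapFactors_mul, swapFactors_kronecker] at this

/-- Whenever `A` maps the positive semidefinite pair `X`, `Y` to multiples of each other by its two
contractions (a singular pair), `A` is block diagonal along the supports of `X` and `Y`. This is the
property of PPT and of SPC matrices that makes the split decomposition work. -/
def SplitsAlongSingularPairs (A : BiMat k m) : Prop :=
  ∀ ⦃l : ℝ⦄ ⦃X : CMat k⦄ ⦃Y : CMat m⦄, 0 < l → X.PosSemidef → Y.PosSemidef →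
    leftContraction A X = l • Y → rightContraction A Y = l • X → SplitsAlong A (supp X) (supp Y)

theorem mul_supp_kronecker_one_sub_supp_eq_zero (hA : A.PosSemidef) (hX : X.PosSemidef)
    (hY : Y.PosSemidef) {l : ℝ} (hXY : leftContraction A X = l • Y) :
    A * (supp X ⊗ₖ (1 - supp Y)) = 0 := by
  refine mul_supp_kronecker_eq_zero hA hX
    (posSemidef_of_isStarProjection (isStarProjection_supp Y).one_sub) ?_
  rw [hXY, smul_mul, mul_sub, mul_one, mul_supp hY.1, sub_self, smul_zero]

theorem mul_one_sub_supp_kronecker_supp_eq_zero (hA : A.PosSemidef) (hX : X.PosSemidef)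
    (hY : Y.PosSemidef) {l : ℝ} (hYX : rightContraction A Y = l • X) :
    A * ((1 - supp X) ⊗ₖ supp Y) = 0 := by
  refine mul_kronecker_supp_eq_zero hA hY
    (posSemidef_of_isStarProjection (isStarProjection_supp X).one_sub) ?_
  rw [hYX, smul_mul, mul_sub, mul_one, mul_supp hX.1, sub_self, smul_zero]

end SingularPairs

section Schmidt

open Matrix
open scoped TraceInnerProduct

variable {k m n : ℕ} {A : BiMat k m} {lam : Fin n → ℝ} {γ : Fin n → CMat k} {δ : Fin n → CMat m}

namespace IsHermitianSchmidt

theorem orthonormal_fst (h : IsHermitianSchmidt A lam γ δ) : Orthonormal ℝ γ :=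
  (orthonormal_iff_trace_mul_conjTranspose h.herm_left).mpr h.orthonormal_left

theorem swap (h : IsHermitianSchmidt A lam γ δ) : IsHermitianSchmidt (swapFactors A) lam δ γ where
  pos := h.pos
  herm_left := h.herm_right
  herm_right := h.herm_left
  orthonormal_left := h.orthonormal_right
  orthonormal_right := h.orthonormal_left
  eq_sum := by
    ext p q
    simp only [h.eq_sum, swapFactors, submatrix_apply, Matrix.sum_apply, Matrix.smul_apply,
      kroneckerMap_apply, Prod.fst_swap, Prod.snd_swap, mul_comm]

theorem orthonormal_snd (h : IsHermitianSchmidt A lam γ δ) : Orthonormal ℝ δ :=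
  h.swap.orthonormal_fst

end IsHermitianSchmidt

theorem leftContraction_sum_smul_kronecker (hγ : ∀ i, (γ i).IsHermitian) {X : CMat k}
    (hX : X.IsHermitian) : leftContraction (∑ i, (lam i : ℂ) • (γ i ⊗ₖ δ i)) X =
      ∑ i, (lam i * inner ℝ (γ i) X) • δ i := by
  simp only [map_sum, LinearMap.sum_apply, map_smul, LinearMap.smul_apply,
    leftContraction_kronecker, smul_smul]
  refine Finset.sum_congr rfl fun i _ => ?_
  rw [← ofReal_inner_eq_trace_mul (hγ i) hX, ← Complex.ofReal_mul, Complex.coe_smul]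

theorem eq_sum_smul_kronecker_of_leftContraction_eq (hγ : ∀ i, (γ i).IsHermitian)
    (h : ∀ X : CMat k, X.IsHermitian → leftContraction A X = ∑ i, (lam i * inner ℝ (γ i) X) • δ i) :
    A = ∑ i, (lam i : ℂ) • (γ i ⊗ₖ δ i) :=
  eq_of_leftContraction_eq_of_isHermitian fun X hX => by
    rw [h X hX, leftContraction_sum_smul_kronecker hγ hX]

theorem isHermitianSchmidt_of_orthonormal (hlam : ∀ i, 0 < lam i) (hγ : ∀ i, (γ i).IsHermitian)
    (hδ : ∀ i, (δ i).IsHermitian) (hγo : Orthonormal ℝ γ) (hδo : Orthonormal ℝ δ)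
    (hA : A = ∑ i, (lam i : ℂ) • (γ i ⊗ₖ δ i)) : IsHermitianSchmidt A lam γ δ :=
  ⟨hlam, hγ, hδ, (orthonormal_iff_trace_mul_conjTranspose hγ).mp hγo,
    (orthonormal_iff_trace_mul_conjTranspose hδ).mp hδo, hA⟩

namespace IsHermitianSchmidt

theorem leftContraction_apply (h : IsHermitianSchmidt A lam γ δ) {X : CMat k} (hX : X.IsHermitian) :
    leftContraction A X = ∑ i, (lam i * inner ℝ (γ i) X) • δ i := by
  rw [h.eq_sum, leftContraction_sum_smul_kronecker h.herm_left hX]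

theorem rightContraction_apply (h : IsHermitianSchmidt A lam γ δ) {Y : CMat m}
    (hY : Y.IsHermitian) : rightContraction A Y = ∑ i, (lam i * inner ℝ (δ i) Y) • γ i :=
  h.swap.leftContraction_apply hY

end IsHermitianSchmidt

end Schmidt

section SPC

open Matrix
open scoped TraceInnerProduct

variable {k : ℕ} {A : BiMat k k}

theorem IsSPC.eq_of_singularPair (hA : IsSPC A) {X Y : CMat k} (hX : X.IsHermitian)
    (hY : Y.IsHermitian) {l : ℝ} (hl : 0 < l) (hXY : leftContraction A X = l • Y)
    (hYX : rightContraction A Y = l • X) : X = Y := by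
  obtain ⟨n, lam, γ, h⟩ := hA.2
  -- On Hermitian matrices both contractions agree with a positive operator.
  let T : CMat k →ₗ[ℝ] CMat k := ∑ i, lam i • (innerₗ _ (γ i)).smulRight (γ i)
  have hT : ∀ Z, T Z = ∑ i, (lam i * inner ℝ (γ i) Z) • γ i := fun Z => by
    simp [T, LinearMap.sum_apply, smul_smul]
  refine eq_of_apply_eq_smul_of_nonneg (𝕜 := ℝ) (T := T) (fun Z => ?_) hl ?_ ?_
  · rw [hT, RCLike.re_to_real, sum_inner]
    refine Finset.sum_nonneg fun i _ => ?_
    rw [real_inner_smul_left, mul_assoc]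
    exact mul_nonneg (h.pos i).le (mul_self_nonneg (inner ℝ (γ i) Z))
  · rw [hT, ← h.leftContraction_apply hX, hXY]
    rfl
  · rw [hT, ← h.rightContraction_apply hY, hYX]
    rfl

theorem commute_of_mul_one_sub_eq_zero {γ V : CMat k} (hγ : γ.IsHermitian)
    (hV : V.IsHermitian) (h : V * γ * (1 - V) = 0) : Commute V γ := by
  have h' : (1 - V) * γ * V = 0 := by
    simpa [hγ.eq, hV.eq, Matrix.mul_assoc] using congrArg conjTranspose h
  rw [mul_sub, mul_one, sub_eq_zero] at h
  rw [sub_mul, one_mul, sub_mul, sub_eq_zero] at h'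
  exact h.trans h'.symm

theorem IsSPC.splitsAlongSingularPairs (hA : IsSPC A) : SplitsAlongSingularPairs A := by
  intro l X Y hl hX hY hXY hYX
  obtain rfl := hA.eq_of_singularPair hX.1 hY.1 hl hXY hYX
  set V := supp X with hV
  have hVV' : A * (V ⊗ₖ (1 - V)) = 0 := mul_supp_kronecker_one_sub_supp_eq_zero hA.1 hX hY hXY
  have hV'V : A * ((1 - V) ⊗ₖ V) = 0 := mul_one_sub_supp_kronecker_supp_eq_zero hA.1 hX hY hYX
  obtain ⟨n, lam, γ, h⟩ := hA.2
  have hoff : ∀ i, V * γ i * (1 - V) = 0 := by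
    refine eq_zero_of_sum_smul_kronecker_conjTranspose_eq_zero h.pos ?_
    have := congrArg ((V ⊗ₖ (1 - V)) * ·) hV'V
    simp only [h.eq_sum, Finset.mul_sum, Finset.sum_mul, smul_mul, Matrix.mul_smul,
      ← mul_kronecker_mul, mul_zero] at this
    simpa [Matrix.mul_assoc, (isHermitian_supp X).eq, (h.herm_left _).eq, hV] using this
  have hcomm : ∀ i, Commute V (γ i) := fun i =>
    commute_of_mul_one_sub_eq_zero (h.herm_left i) (isHermitian_supp X) (hoff i)
  refine ⟨?_, ?_, mul_kronecker_one_eq_mul_one_kronecker hVV' hV'V⟩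
  all_goals
    rw [h.eq_sum]
    refine Commute.sum_right _ _ _ fun i _ => .smul_right ?_ _
    rw [commute_iff_eq, ← mul_kronecker_mul, ← mul_kronecker_mul, (hcomm i).eq, one_mul, mul_one]

end SPC

section PPT

open Matrix

variable {k m : ℕ} {A : BiMat k m}

theorem leftContraction_partialTranspose (A : BiMat k m) (X : CMat k) :
    leftContraction (partialTranspose A) X = leftContraction A Xᵀ := by
  ext b b'
  simp only [leftContraction_apply_apply, partialTranspose, of_apply, transpose_apply]
  exact Finset.sum_comm

theorem partialTranspose_kronecker_mul_mul_kronecker (V V' : CMat k) (W W' : CMat m)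
    (A : BiMat k m) : partialTranspose ((V ⊗ₖ W) * A * (V' ⊗ₖ W')) =
      (V'ᵀ ⊗ₖ W) * partialTranspose A * (Vᵀ ⊗ₖ W') := by
  refine leftContraction_injective (LinearMap.ext fun X => ?_)
  simp only [leftContraction_partialTranspose, leftContraction_mul_kronecker,
    leftContraction_kronecker_mul, transpose_mul, transpose_transpose, Matrix.mul_assoc]

theorem partialTranspose_eq_zero_iff : partialTranspose A = 0 ↔ A = 0 := by
  refine ⟨fun h => ?_, fun h => by rw [h]; rfl⟩
  ext p q
  exact congrFun (congrFun h (q.1, p.2)) (p.1, q.2)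

theorem IsPPT.kronecker_mul_mul_kronecker_eq_zero (hA : IsPPT A) {X : CMat k} (hX : X.PosSemidef)
    {Z : CMat m} (hZ : Z.PosSemidef) (h : A * (X ⊗ₖ Z) = 0) :
    (X ⊗ₖ 1) * A * (1 ⊗ₖ Z) = 0 := by
  rw [← partialTranspose_eq_zero_iff, partialTranspose_kronecker_mul_mul_kronecker, transpose_one,
    one_kronecker_one, one_mul]
  refine mul_eq_zero_of_trace_mul_eq_zero hA.2 (hX.transpose.kronecker hZ) ?_
  rw [trace_mul_kronecker, leftContraction_partialTranspose, transpose_transpose,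
    ← trace_mul_kronecker, h, trace_zero]

theorem IsPPT.splitsAlongSingularPairs (hA : IsPPT A) : SplitsAlongSingularPairs A := by
  intro l X Y _ hX hY hXY hYX
  set V := supp X
  set W := supp Y
  have hV : IsStarProjection V := isStarProjection_supp X
  have hW : IsStarProjection W := isStarProjection_supp Y
  have hVW' : A * (V ⊗ₖ (1 - W)) = 0 := mul_supp_kronecker_one_sub_supp_eq_zero hA.1 hX hY hXY
  have hV'W : A * ((1 - V) ⊗ₖ W) = 0 := mul_one_sub_supp_kronecker_supp_eq_zero hA.1 hX hY hYX
  have hVA : (V ⊗ₖ 1) * A = A * (1 ⊗ₖ W) := by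
    have h₁ := hA.kronecker_mul_mul_kronecker_eq_zero (posSemidef_of_isStarProjection hV)
      (posSemidef_of_isStarProjection hW.one_sub) hVW'
    have h₂ := hA.kronecker_mul_mul_kronecker_eq_zero (posSemidef_of_isStarProjection hV.one_sub)
      (posSemidef_of_isStarProjection hW) hV'W
    calc (V ⊗ₖ 1) * A = (V ⊗ₖ 1) * A * (1 ⊗ₖ (1 - W)) + (V ⊗ₖ 1) * A * (1 ⊗ₖ W) := by
          rw [← mul_add, ← kronecker_add, sub_add_cancel, one_kronecker_one, mul_one]
      _ = ((1 - V) ⊗ₖ 1) * A * (1 ⊗ₖ W) + (V ⊗ₖ 1) * A * (1 ⊗ₖ W) := by rw [h₁, h₂]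
      _ = A * (1 ⊗ₖ W) := by
          rw [← add_mul, ← add_mul, ← add_kronecker, sub_add_cancel, one_kronecker_one, one_mul]
  have hAV : A * (V ⊗ₖ 1) = (1 ⊗ₖ W) * A := by
    have := congrArg conjTranspose hVA
    rwa [conjTranspose_mul, conjTranspose_mul, conjTranspose_kronecker, conjTranspose_kronecker,
      conjTranspose_one, conjTranspose_one, hA.1.1.eq, (isHermitian_supp X).eq,
      (isHermitian_supp Y).eq] at this
  have hmul := mul_kronecker_one_eq_mul_one_kronecker hVW' hV'W
  exact ⟨hVA.trans hmul.symm, hAV.symm.trans hmul, hmul⟩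

theorem posSemidef_compress {V : CMat k} {W : CMat m} (hV : V.IsHermitian) (hW : W.IsHermitian)
    (hA : A.PosSemidef) : (compress V W A).PosSemidef := by
  have := hA.mul_mul_conjTranspose_same (V ⊗ₖ W)
  rwa [conjTranspose_kronecker, hV.eq, hW.eq] at this

theorem IsPPT.compress {V : CMat k} {W : CMat m} (hV : V.IsHermitian) (hW : W.IsHermitian)
    (hA : IsPPT A) : IsPPT (compress V W A) := by
  refine ⟨posSemidef_compress hV hW hA.1, ?_⟩
  rw [_root_.compress, partialTranspose_kronecker_mul_mul_kronecker]
  exact posSemidef_compress hV.transpose hW hA.2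

end PPT

section SingularSpace

open Matrix
open scoped TraceInnerProduct

variable {k m n : ℕ} {A : BiMat k m} {lam : Fin n → ℝ} {γ : Fin n → CMat k} {δ : Fin n → CMat m}
  {l : ℝ} {X : CMat k}

/-- The real space of Hermitian left singular vectors of `A` for the singular value `l`. -/
noncomputable def singularSpace (A : BiMat k m) (l : ℝ) : Submodule ℝ (CMat k) where
  carrier := {X | X.IsHermitian ∧ rightContraction A (leftContraction A X) = l ^ 2 • X}
  add_mem' hX hY := ⟨hX.1.add hY.1, by rw [map_add, map_add, hX.2, hY.2, smul_add]⟩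
  zero_mem' := ⟨isHermitian_zero, by rw [map_zero, map_zero, smul_zero]⟩
  smul_mem' c X hX := ⟨hX.1.smul (.all c), by
    rw [LinearMap.map_smul_of_tower, LinearMap.map_smul_of_tower, hX.2, smul_comm]⟩

theorem SplitsAlong.mul_mem_singularSpace {V : CMat k} {W : CMat m} (h : SplitsAlong A V W)
    (hV : V.IsHermitian) (hVX : Commute V X) (hX : X ∈ singularSpace A l) :
    V * X ∈ singularSpace A l := by
  refine ⟨?_, ?_⟩
  · rw [IsHermitian, conjTranspose_mul, hX.1.eq, hV.eq, hVX.eq]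
  · rw [h.leftContraction_mul_left, rightContraction, h.swapFactors.leftContraction_mul_left,
      ← rightContraction, hX.2, Matrix.mul_smul]

namespace IsHermitianSchmidt

theorem leftContraction_left (h : IsHermitianSchmidt A lam γ δ) (i : Fin n) :
    leftContraction A (γ i) = lam i • δ i := by
  rw [h.leftContraction_apply (h.herm_left i)]
  simp [orthonormal_iff_ite.mp h.orthonormal_fst, ite_smul]

theorem rightContraction_right (h : IsHermitianSchmidt A lam γ δ) (i : Fin n) :
    rightContraction A (δ i) = lam i • γ i :=
  h.swap.leftContraction_left i

theorem rightContraction_leftContraction_apply (h : IsHermitianSchmidt A lam γ δ)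
    (hX : X.IsHermitian) :
    rightContraction A (leftContraction A X) = ∑ i, (lam i ^ 2 * inner ℝ (γ i) X) • γ i := by
  rw [h.leftContraction_apply hX, map_sum]
  refine Finset.sum_congr rfl fun i _ => ?_
  rw [LinearMap.map_smul_of_tower, h.rightContraction_right, smul_smul, mul_right_comm, ← sq]

end IsHermitianSchmidt

end SingularSpace

section SplitsAlongSingularPairs

open Matrix

variable {k m : ℕ} {A : BiMat k m} {V : CMat k} {W : CMat m}

theorem SplitsAlong.rightContraction_mul_left (h : SplitsAlong A V W) (Y : CMat m) :
    rightContraction A (W * Y) = V * rightContraction A Y :=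
  h.swapFactors.leftContraction_mul_left Y

theorem SplitsAlong.commute_rightContraction (h : SplitsAlong A V W) (Y : CMat m) :
    Commute V (rightContraction A Y) :=
  h.swapFactors.commute_leftContraction Y

theorem SplitsAlong.rightContraction_mul_kronecker_one (h : SplitsAlong A V W) (Y : CMat m) :
    rightContraction (A * (V ⊗ₖ 1)) Y = V * rightContraction A Y := by
  rw [h.mul_eq_mul, rightContraction, swapFactors_mul, swapFactors_kronecker,
    leftContraction_mul_kronecker, mul_one, ← rightContraction, h.rightContraction_mul_left]

theorem SplitsAlongSingularPairs.mul_kronecker_one (hS : SplitsAlongSingularPairs A)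
    (h : SplitsAlong A V W) (hV : IsStarProjection V) :
    SplitsAlongSingularPairs (A * (V ⊗ₖ 1)) := by
  intro l X Y hl hX hY hXY hYX
  rw [leftContraction_mul_kronecker, mul_one] at hXY
  rw [h.rightContraction_mul_kronecker_one] at hYX
  have hVX : V * X = X := smul_right_injective _ hl.ne' <| by
    simp only [← Matrix.mul_smul, ← hYX, ← mul_assoc, hV.1.eq]
  have hsupp : V * supp X = supp X := by
    obtain ⟨Z, hZ⟩ := exists_mul_eq_supp X
    rw [← hZ, ← mul_assoc, hVX]
  have hVH : V.IsHermitian := hV.2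
  have hcomm : Commute V (supp X) := by
    have := congrArg conjTranspose hsupp
    rw [conjTranspose_mul, (isHermitian_supp X).eq, hVH.eq] at this
    rw [commute_iff_eq, hsupp, this]
  rw [hVX] at hXY
  have hWY : W * Y = Y := smul_right_injective _ hl.ne' <| by
    simp only [← Matrix.mul_smul, ← hXY, ← h.leftContraction_mul_left, hVX]
  refine .mul_kronecker_one hcomm (hS hl hX hY hXY ?_)
  rw [← hYX, ← h.rightContraction_mul_left, hWY]

end SplitsAlongSingularPairs

section SplitData

open Matrix
open scoped TraceInnerProduct

theorem sum_filter_val_lt_eq_sum_castLE {M : Type*} [AddCommMonoid M] {n s : ℕ} (h : s ≤ n)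
    (f : Fin n → M) :
    ∑ i ∈ Finset.univ.filter (fun i : Fin n => (i : ℕ) < s), f i = ∑ i, f (Fin.castLE h i) := by
  refine (Finset.sum_bij (fun i _ => Fin.castLE h i) (by simp)
    (fun i _ j _ hij => Fin.castLE_injective h hij) (fun j hj => ?_) fun _ _ => rfl).symm
  exact ⟨⟨j, (Finset.mem_filter.mp hj).2⟩, Finset.mem_univ _, rfl⟩

theorem sum_kronecker {ι κ κ' μ μ' R : Type*} [CommSemiring R] (s : Finset ι)
    (C : ι → Matrix κ κ' R) (D : Matrix μ μ' R) : (∑ i ∈ s, C i) ⊗ₖ D = ∑ i ∈ s, C i ⊗ₖ D := by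
  ext
  simp only [kroneckerMap_apply, Matrix.sum_apply, Finset.sum_mul]

variable {k m n s : ℕ} {A : BiMat k m} {lam : Fin n → ℝ} {γ : Fin n → CMat k} {δ : Fin n → CMat m}
  {γ' : Fin s → CMat k} {δ' : Fin s → CMat m} {l : ℝ} {X : CMat k}

namespace IsHermitianSchmidt

theorem initialSegment (h : IsHermitianSchmidt A lam γ δ) (hs : s ≤ n) : IsHermitianSchmidt
    (∑ i ∈ Finset.univ.filter (fun i : Fin n => (i : ℕ) < s), γ i ⊗ₖ δ i)
    (fun _ : Fin s => (1 : ℝ)) (γ ∘ Fin.castLE hs) (δ ∘ Fin.castLE hs) :=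
  isHermitianSchmidt_of_orthonormal (fun _ => one_pos) (fun _ => h.herm_left _)
    (fun _ => h.herm_right _) (h.orthonormal_fst.comp _ (Fin.castLE_injective hs))
    (h.orthonormal_snd.comp _ (Fin.castLE_injective hs))
    (by simp [sum_filter_val_lt_eq_sum_castLE hs])

theorem eq_sum_inner_smul_of_mem_singularSpace (h : IsHermitianSchmidt A lam γ δ) (hs : s ≤ n)
    (hl : 0 < l) (htop : ∀ i : Fin n, (i : ℕ) < s → lam i = l)
    (hgt : ∀ i : Fin n, s ≤ (i : ℕ) → lam i < l) (hX : X ∈ singularSpace A l) :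
    X = ∑ i : Fin s, inner ℝ (γ (Fin.castLE hs i)) X • γ (Fin.castLE hs i) := by
  have hFG := h.rightContraction_leftContraction_apply hX.1
  rw [hX.2] at hFG
  have hzero : ∀ i : Fin n, s ≤ (i : ℕ) → inner ℝ (γ i) X = 0 := fun i hi => by
    have hi' : l ^ 2 * inner ℝ (γ i) X = lam i ^ 2 * inner ℝ (γ i) X := by
      rw [← real_inner_smul_right, hFG, h.orthonormal_fst.inner_right_fintype]
    have hlt : lam i ^ 2 < l ^ 2 := pow_lt_pow_left₀ (hgt i hi) (h.pos i).le two_ne_zero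
    have : (l ^ 2 - lam i ^ 2) * inner ℝ (γ i) X = 0 := by rw [sub_mul, hi', sub_self]
    exact (mul_eq_zero.mp this).resolve_left (sub_pos.mpr hlt).ne'
  have hterm : ∀ i, lam i ^ 2 * inner ℝ (γ i) X = l ^ 2 * inner ℝ (γ i) X := fun i => by
    rcases lt_or_ge (i : ℕ) s with hi | hi
    · rw [htop i hi]
    · rw [hzero i hi, mul_zero, mul_zero]
  have hsum : X = ∑ i, inner ℝ (γ i) X • γ i := by
    simp only [hterm, mul_smul, ← Finset.smul_sum] at hFG
    exact smul_right_injective _ (pow_ne_zero 2 hl.ne') hFG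
  conv_lhs => rw [hsum]
  rw [← sum_filter_val_lt_eq_sum_castLE hs (fun i => inner ℝ (γ i) X • γ i),
    Finset.sum_filter_of_ne]
  intro i _ hi
  by_contra hlt
  rw [hzero i (not_lt.mp hlt), zero_smul] at hi
  exact hi rfl

end IsHermitianSchmidt

namespace IsSplitData

variable (h : IsSplitData A lam γ δ γ' δ')
include h

theorem exists_top : ∃ l, 0 < l ∧ (∀ i : Fin n, (i : ℕ) < s → lam i = l) ∧
    ∀ i : Fin n, s ≤ (i : ℕ) → lam i < l :=
  have hn : 0 < n := h.one_le.trans h.le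
  ⟨lam ⟨0, hn⟩, h.schmidt.pos _, fun _ hi => h.top_eq _ _ hi h.one_le,
    fun _ hi => h.top_gt _ _ h.one_le hi⟩

theorem leftContraction_left (htop : ∀ i : Fin n, (i : ℕ) < s → lam i = l) (j : Fin s) :
    leftContraction A (γ' j) = l • δ' j := by
  have hD := h.schmidt.initialSegment h.le
  have hδ' := hD.leftContraction_apply (h.schmidt_top.herm_left j)
  have hγ' := hD.rightContraction_leftContraction_apply (h.schmidt_top.herm_left j)
  simp only [h.schmidt_top.leftContraction_left, h.schmidt_top.rightContraction_right, one_smul,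
    one_pow, one_mul, Function.comp_apply] at hδ' hγ'
  conv_lhs => rw [hγ', map_sum]
  rw [hδ', Finset.smul_sum]
  refine Finset.sum_congr rfl fun i _ => ?_
  rw [LinearMap.map_smul_of_tower, h.schmidt.leftContraction_left, htop _ i.2, smul_comm]

theorem swap : IsSplitData (swapFactors A) lam δ γ δ' γ' where
  schmidt := h.schmidt.swap
  antitone := h.antitone
  one_le := h.one_le
  le := h.le
  top_eq := h.top_eq
  top_gt := h.top_gt
  schmidt_top := by
    convert h.schmidt_top.swap using 1
    ext p q
    simp [swapFactors, Matrix.sum_apply, mul_comm]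
  posSemidef_left := h.posSemidef_right
  posSemidef_right := h.posSemidef_left

theorem rightContraction_right (htop : ∀ i : Fin n, (i : ℕ) < s → lam i = l) (j : Fin s) :
    rightContraction A (δ' j) = l • γ' j :=
  h.swap.leftContraction_left htop j

theorem eq_sum_inner_smul_of_mem_singularSpace (hl : 0 < l)
    (htop : ∀ i : Fin n, (i : ℕ) < s → lam i = l) (hgt : ∀ i : Fin n, s ≤ (i : ℕ) → lam i < l)
    (hX : X ∈ singularSpace A l) : X = ∑ j, inner ℝ (γ' j) X • γ' j := by
  have hγ := (h.schmidt.initialSegment h.le).rightContraction_leftContraction_apply hX.1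
  have hγ' := h.schmidt_top.rightContraction_leftContraction_apply hX.1
  simp only [one_pow, one_mul, Function.comp_apply] at hγ hγ'
  rw [← hγ', hγ]
  exact h.schmidt.eq_sum_inner_smul_of_mem_singularSpace h.le hl htop hgt hX

theorem mul_eq_zero_left : Pairwise fun i j => γ' i * γ' j = 0 := fun i j hij =>
  mul_eq_zero_of_inner_eq_zero (h.posSemidef_left i) (h.posSemidef_left j)
    (h.schmidt_top.orthonormal_fst.2 hij)

theorem splitsAlong_supp (hS : SplitsAlongSingularPairs A) (j : Fin s) :
    SplitsAlong A (supp (γ' j)) (supp (δ' j)) := by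
  obtain ⟨l, hl, htop, -⟩ := h.exists_top
  exact hS hl (h.posSemidef_left j) (h.posSemidef_right j) (h.leftContraction_left htop j)
    (h.rightContraction_right htop j)

theorem complProj_left : complProj γ' = 1 + -∑ j, supp (γ' j) := by
  rw [← complProj_add_sum_supp (fun j => (h.posSemidef_left j).1) h.mul_eq_zero_left,
    add_neg_cancel_right]

theorem splitsAlong_complProj (hS : SplitsAlongSingularPairs A) :
    SplitsAlong A (complProj γ') (complProj δ') := by
  rw [h.complProj_left, h.swap.complProj_left]
  exact SplitsAlong.one_one.add (SplitsAlong.sum _ fun j _ => h.splitsAlong_supp hS j).neg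

theorem splitPiece_eq (hS : SplitsAlongSingularPairs A) (j : Fin s) :
    splitPiece A γ' δ' j = A * (supp (γ' j) ⊗ₖ 1) :=
  (h.splitsAlong_supp hS j).compress_eq (isStarProjection_supp _).1 (isStarProjection_supp _).1

theorem splitRemainder_eq (hS : SplitsAlongSingularPairs A) :
    splitRemainder A γ' δ' = A * (complProj γ' ⊗ₖ 1) :=
  (h.splitsAlong_complProj hS).compress_eq (isStarProjection_complProj _).1
    (isStarProjection_complProj _).1

theorem eq_sum_splitPiece_add_splitRemainder (hS : SplitsAlongSingularPairs A) :
    A = ∑ j, splitPiece A γ' δ' j + splitRemainder A γ' δ' := by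
  have hsum : ∑ j, splitPiece A γ' δ' j = A * ((∑ j, supp (γ' j)) ⊗ₖ 1) := by
    simp only [h.splitPiece_eq hS, ← Finset.mul_sum]
    rw [sum_kronecker]
  rw [hsum, h.splitRemainder_eq hS, ← mul_add, ← add_kronecker, h.complProj_left,
    add_neg_cancel_comm_assoc, one_kronecker_one, mul_one]

theorem leftContraction_splitPiece_left (hS : SplitsAlongSingularPairs A) (j : Fin s) :
    leftContraction (splitPiece A γ' δ' j) (γ' j) = leftContraction A (γ' j) := by
  rw [h.splitPiece_eq hS, leftContraction_mul_kronecker, supp_mul, mul_one]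

theorem left_ne_zero (j : Fin s) : γ' j ≠ 0 := h.schmidt_top.orthonormal_fst.ne_zero j

theorem leftContraction_left_ne_zero (j : Fin s) : leftContraction A (γ' j) ≠ 0 := by
  obtain ⟨l, hl, htop, -⟩ := h.exists_top
  rw [h.leftContraction_left htop]
  exact smul_ne_zero hl.ne' (h.swap.left_ne_zero j)

theorem splitPiece_ne_zero (hS : SplitsAlongSingularPairs A) (j : Fin s) :
    splitPiece A γ' δ' j ≠ 0 := fun h0 => by
  have := h.leftContraction_splitPiece_left hS j
  rw [h0, map_zero, LinearMap.zero_apply] at this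
  exact h.leftContraction_left_ne_zero j this.symm

theorem complProj_mul_left (j : Fin s) : complProj γ' * γ' j = 0 := by
  rw [h.complProj_left, add_mul, one_mul, neg_mul, Finset.sum_mul, Finset.sum_eq_single j
    (fun i _ hij => supp_mul_eq_zero (h.posSemidef_left i).1 (h.mul_eq_zero_left hij)) (by simp),
    supp_mul, add_neg_cancel]

theorem ker_leftContraction_lt_ker_splitRemainder (hS : SplitsAlongSingularPairs A) :
    LinearMap.ker (leftContraction A) <
      LinearMap.ker (leftContraction (splitRemainder A γ' δ')) := by
  have happly : ∀ X, leftContraction (splitRemainder A γ' δ') X =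
      leftContraction A (complProj γ' * X) := fun X => by
    rw [h.splitRemainder_eq hS, leftContraction_mul_kronecker, mul_one]
  refine SetLike.lt_iff_le_and_exists.mpr ⟨fun X hX => ?_, γ' ⟨0, h.one_le⟩, ?_, ?_⟩
  · rw [LinearMap.mem_ker] at hX ⊢
    rw [happly, (h.splitsAlong_complProj hS).leftContraction_mul_left, hX, mul_zero]
  · rw [LinearMap.mem_ker, happly, h.complProj_mul_left, map_zero]
  · exact h.leftContraction_left_ne_zero _

theorem splitsAlongSingularPairs_splitRemainder (hS : SplitsAlongSingularPairs A) :
    SplitsAlongSingularPairs (splitRemainder A γ' δ') := by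
  rw [h.splitRemainder_eq hS]
  exact hS.mul_kronecker_one (h.splitsAlong_complProj hS) (isStarProjection_complProj _)

end IsSplitData

end SplitData

section WeakIrreducible

open Matrix
open scoped TraceInnerProduct

variable {k m n s : ℕ} {A : BiMat k m} {lam : Fin n → ℝ} {γ : Fin n → CMat k} {δ : Fin n → CMat m}
  {γ' : Fin s → CMat k} {δ' : Fin s → CMat m} {l : ℝ}

theorem SplitsAlong.mem_singularSpace_mul_kronecker_one_iff {V X : CMat k} {W : CMat m}
    (h : SplitsAlong A V W) (hX : V * X = X) :
    X ∈ singularSpace (A * (V ⊗ₖ 1)) l ↔ X ∈ singularSpace A l := by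
  refine and_congr_right fun _ => ?_
  rw [h.rightContraction_mul_kronecker_one, leftContraction_mul_kronecker, mul_one,
    ← h.rightContraction_mul_left, ← h.leftContraction_mul_left, hX, hX]

namespace IsSplitData

variable (h : IsSplitData A lam γ δ γ' δ')
include h

theorem left_mem_singularSpace (htop : ∀ i : Fin n, (i : ℕ) < s → lam i = l) (j : Fin s) :
    γ' j ∈ singularSpace A l :=
  ⟨(h.posSemidef_left j).1, by
    rw [h.leftContraction_left htop, LinearMap.map_smul_of_tower, h.rightContraction_right htop,
      smul_smul, sq]⟩

variable {V : CMat k} {W : CMat m} {j : Fin s}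

theorem commute_left_of_splitsAlong_splitPiece (hS : SplitsAlongSingularPairs A)
    (hVW : SplitsAlong (splitPiece A γ' δ' j) V W) : Commute V (γ' j) := by
  obtain ⟨l, hl, htop, -⟩ := h.exists_top
  have := hVW.commute_rightContraction (δ' j)
  rw [h.splitPiece_eq hS, (h.splitsAlong_supp hS j).rightContraction_mul_kronecker_one,
    h.rightContraction_right htop, Matrix.mul_smul, supp_mul] at this
  simpa [smul_smul, inv_mul_cancel₀ hl.ne'] using this.smul_right l⁻¹

theorem exists_mul_left_eq_smul (hS : SplitsAlongSingularPairs A)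
    (hVW : SplitsAlong (splitPiece A γ' δ' j) V W) (hV : V.IsHermitian) :
    ∃ c : ℝ, V * γ' j = c • γ' j := by
  obtain ⟨l, hl, htop, hgt⟩ := h.exists_top
  have hcomm : Commute V (γ' j) := h.commute_left_of_splitsAlong_splitPiece hS hVW
  have hmem : V * γ' j ∈ singularSpace A l := by
    have hj := h.splitsAlong_supp hS j
    rw [h.splitPiece_eq hS] at hVW
    rw [← hj.mem_singularSpace_mul_kronecker_one_iff (by rw [hcomm.eq, ← mul_assoc, supp_mul])]
    refine hVW.mul_mem_singularSpace hV hcomm ?_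
    rw [hj.mem_singularSpace_mul_kronecker_one_iff (supp_mul _)]
    exact h.left_mem_singularSpace htop j
  refine ⟨inner ℝ (γ' j) (V * γ' j), ?_⟩
  conv_lhs => rw [h.eq_sum_inner_smul_of_mem_singularSpace hl htop hgt hmem]
  refine Finset.sum_eq_single j (fun i _ hij => ?_) (by simp)
  rw [inner_eq_zero_of_mul_eq_zero hmem.1, zero_smul]
  rw [hcomm.eq, ← mul_assoc, h.mul_eq_zero_left hij, zero_mul]

theorem compress_splitPiece_eq_zero (hS : SplitsAlongSingularPairs A)
    (hVW : SplitsAlong (splitPiece A γ' δ' j) V W) (hV : IsIdempotentElem V)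
    (hW : IsIdempotentElem W) (hVj : V * γ' j = 0) : compress V W (splitPiece A γ' δ' j) = 0 := by
  have hjV : γ' j * V = 0 := (h.commute_left_of_splitsAlong_splitPiece hS hVW).eq ▸ hVj
  rw [hVW.compress_eq hV hW, h.splitPiece_eq hS, mul_assoc, ← mul_kronecker_mul,
    supp_mul_eq_zero (h.posSemidef_left j).1 hjV, zero_kronecker, mul_zero]

theorem isWeakIrreducible_splitPiece (hA : A.PosSemidef) (hS : SplitsAlongSingularPairs A)
    (j : Fin s) : IsWeakIrreducible (splitPiece A γ' δ' j) := by
  refine ⟨posSemidef_compress (isHermitian_supp _) (isHermitian_supp _) hA, ?_⟩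
  intro V₁ V₂ W₁ W₂ hV₁ hV₂ hW₁ hW₂ hV hW hV1 _ hB
  have h₁ := splitsAlong_of_eq_compress_add_compress hV₁ hV₂ hW₁ hW₂ hV hW hB
  have h₂ := splitsAlong_of_eq_compress_add_compress hV₂ hV₁ hW₂ hW₁
    (mul_eq_zero_comm_of_isHermitian hV₁.2 hV₂.2 hV)
    (mul_eq_zero_comm_of_isHermitian hW₁.2 hW₂.2 hW) (by rwa [add_comm])
  obtain ⟨c, hc⟩ := h.exists_mul_left_eq_smul hS h₁ hV₁.2
  have hcc : IsIdempotentElem c := smul_left_injective ℝ (h.left_ne_zero j) <| by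
    simp only [mul_smul]
    rw [← hc, ← Matrix.mul_smul, ← hc, ← mul_assoc, hV₁.1.eq]
  rcases IsIdempotentElem.iff_eq_zero_or_one.mp hcc with rfl | rfl
  · exact .inl (h.compress_splitPiece_eq_zero hS h₁ hV₁.1 hW₁.1 (by rw [hc, zero_smul]))
  · refine .inr (h.compress_splitPiece_eq_zero hS h₂ hV₂.1 hW₂.1 ?_)
    rw [eq_sub_of_add_eq' hV1, sub_mul, one_mul, hc, one_smul, sub_self]

end IsSplitData

end WeakIrreducible

section PosLattice

open Matrix
open scoped TraceInnerProduct

variable {k : ℕ} {S : Submodule ℝ (CMat k)} {X Y U : CMat k}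

/-- A real space of Hermitian matrices which contains the positive and negative parts of its
elements and is stable under multiplication by the supports of its positive semidefinite elements.
Such a space has an orthonormal basis of positive semidefinite matrices. -/
structure IsPosLattice (S : Submodule ℝ (CMat k)) : Prop where
  isHermitian : ∀ ⦃X⦄, X ∈ S → X.IsHermitian
  exists_sub : ∀ ⦃X⦄, X ∈ S →
    ∃ P ∈ S, ∃ N ∈ S, P.PosSemidef ∧ N.PosSemidef ∧ X = P - N ∧ P * N = 0
  supp_mul_mem : ∀ ⦃X Y⦄, X ∈ S → X.PosSemidef → Y ∈ S → supp X * Y ∈ S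

namespace IsPosLattice

theorem commute_supp (h : IsPosLattice S) (hX : X ∈ S) (hXpos : X.PosSemidef) (hY : Y ∈ S) :
    Commute (supp X) Y :=
  ((isHermitian_supp X).commute_iff (h.isHermitian hY)).mpr
    (h.isHermitian (h.supp_mul_mem hX hXpos hY))

theorem inf_ker_mulLeft (h : IsPosLattice S) (hU : U.IsHermitian) (hUS : ∀ Z ∈ S, Commute U Z) :
    IsPosLattice (S ⊓ LinearMap.ker (LinearMap.mulLeft ℝ U)) := by
  have hmem : ∀ {Z}, Z ∈ S ⊓ LinearMap.ker (LinearMap.mulLeft ℝ U) ↔ Z ∈ S ∧ U * Z = 0 := by simp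
  refine ⟨fun X hX => h.isHermitian hX.1, fun X hX => ?_, fun X Y hX hXpos hY => ?_⟩
  · obtain ⟨hXS, hUX⟩ := hmem.mp hX
    obtain ⟨P, hP, N, hN, hPpos, hNpos, rfl, hPN⟩ := h.exists_sub hXS
    have hUPN : U * P = U * N := by rwa [mul_sub, sub_eq_zero] at hUX
    have hUP : U * P = 0 := by
      have hherm : (U * P).IsHermitian := (hU.commute_iff hPpos.1).mp (hUS P hP)
      rw [← conjTranspose_mul_self_eq_zero, hherm.eq]
      nth_rw 2 [hUPN]
      rw [(hUS P hP).eq, (hUS N hN).eq, mul_assoc, ← mul_assoc U, (hUS N hN).eq, mul_assoc,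
        ← mul_assoc, hPN, zero_mul]
    exact ⟨P, hmem.mpr ⟨hP, hUP⟩, N, hmem.mpr ⟨hN, hUPN ▸ hUP⟩, hPpos, hNpos, rfl, hPN⟩
  · rw [hmem] at hX hY ⊢
    exact ⟨h.supp_mul_mem hX.1 hXpos hY.1, by rw [← mul_assoc, mul_supp_eq_zero hX.2, zero_mul]⟩

theorem le_span_singleton (h : IsPosLattice S)
    (hS : ∀ P ∈ S, ∀ N ∈ S, P.PosSemidef → N.PosSemidef → P * N = 0 → P = 0 ∨ N = 0)
    (hX : X ∈ S) (hXpos : X.PosSemidef) (hX0 : X ≠ 0) : S ≤ Submodule.span ℝ {X} := by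
  intro Z hZ
  have htrace : ∀ {P : CMat k}, P.PosSemidef → inner ℝ 1 P = 0 → P = 0 := fun hP hP0 => by
    simpa using mul_eq_zero_of_inner_eq_zero .one hP hP0
  have hXtr : inner ℝ 1 X ≠ 0 := fun h0 => hX0 (htrace hXpos h0)
  -- `Z - c X` has trace zero, so its positive and negative parts vanish together.
  set c : ℝ := inner ℝ 1 Z / inner ℝ 1 X
  obtain ⟨P, hP, N, hN, hPpos, hNpos, hPN, hmul⟩ := h.exists_sub (S.sub_mem hZ (S.smul_mem c hX))
  have hPN_trace : inner ℝ 1 P = inner ℝ 1 N := by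
    rw [← sub_eq_zero, ← inner_sub_right, ← hPN, inner_sub_right, real_inner_smul_right,
      div_mul_cancel₀ _ hXtr, sub_self]
  have hPN0 : P = 0 ∧ N = 0 := by
    rcases hS P hP N hN hPpos hNpos hmul with rfl | rfl
    · exact ⟨rfl, htrace hNpos (by rw [← hPN_trace, inner_zero_right])⟩
    · exact ⟨htrace hPpos (by rw [hPN_trace, inner_zero_right]), rfl⟩
  rw [hPN0.1, hPN0.2, sub_self, sub_eq_zero] at hPN
  exact Submodule.mem_span_singleton.mpr ⟨c, hPN.symm⟩

theorem exists_posSemidef_ne_zero (h : IsPosLattice S) (hS : S ≠ ⊥) :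
    ∃ X ∈ S, X.PosSemidef ∧ X ≠ 0 := by
  obtain ⟨Z, hZ, hZ0⟩ := S.exists_mem_ne_zero_of_ne_bot hS
  obtain ⟨P, hP, N, hN, hPpos, hNpos, rfl, -⟩ := h.exists_sub hZ
  by_cases hP0 : P = 0
  · exact ⟨N, hN, hNpos, fun hN0 => hZ0 (by rw [hP0, hN0, sub_self])⟩
  · exact ⟨P, hP, hPpos, hP0⟩

end IsPosLattice

theorem sup_inf_ker_mulLeft {K R : Type*} [CommRing K] [Ring R] [Algebra K R] {S : Submodule K R}
    {U : R} (hU : IsIdempotentElem U) (hUS : ∀ Z ∈ S, U * Z ∈ S) :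
    S ⊓ LinearMap.ker (LinearMap.mulLeft K U) ⊔ S ⊓ LinearMap.ker (LinearMap.mulLeft K (1 - U)) =
      S := by
  refine le_antisymm (sup_le inf_le_left inf_le_left) fun Z hZ => ?_
  refine Submodule.mem_sup.mpr ⟨Z - U * Z, ⟨S.sub_mem hZ (hUS Z hZ), ?_⟩, U * Z, ⟨hUS Z hZ, ?_⟩,
    sub_add_cancel _ _⟩
  · simp [mul_sub, ← mul_assoc, hU.eq]
  · simp [sub_mul, ← mul_assoc, hU.eq]

theorem exists_orthonormal_append {E : Type*} [NormedAddCommGroup E] [InnerProductSpace ℝ E]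
    {p : E → Prop} {S T : Submodule ℝ E} (hST : S ⟂ T)
    (hS : ∃ (s : ℕ) (u : Fin s → E), Orthonormal ℝ u ∧ (∀ i, p (u i)) ∧
      Submodule.span ℝ (Set.range u) = S)
    (hT : ∃ (t : ℕ) (v : Fin t → E), Orthonormal ℝ v ∧ (∀ i, p (v i)) ∧
      Submodule.span ℝ (Set.range v) = T) :
    ∃ (r : ℕ) (w : Fin r → E), Orthonormal ℝ w ∧ (∀ i, p (w i)) ∧
      Submodule.span ℝ (Set.range w) = S ⊔ T := by
  obtain ⟨s, u, hu, hpu, rfl⟩ := hS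
  obtain ⟨t, v, hv, hpv, rfl⟩ := hT
  have huv : ∀ i j, inner ℝ (u i) (v j) = 0 := fun i j =>
    hST.inner_eq (Submodule.subset_span ⟨i, rfl⟩) (Submodule.subset_span ⟨j, rfl⟩)
  have hw : Orthonormal ℝ (Sum.elim u v) := by
    refine ⟨Sum.rec hu.1 hv.1, ?_⟩
    rintro (i | i) (j | j) hij
    · exact hu.2 fun h => hij (congrArg Sum.inl h)
    · exact huv i j
    · exact (real_inner_comm _ _).trans (huv j i)
    · exact hv.2 fun h => hij (congrArg Sum.inr h)
  refine ⟨s + t, Sum.elim u v ∘ finSumFinEquiv.symm, hw.comp _ finSumFinEquiv.symm.injective,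
    fun i => ?_, ?_⟩
  · exact Sum.rec (motive := fun x => p (Sum.elim u v x)) hpu hpv (finSumFinEquiv.symm i)
  · rw [EquivLike.range_comp, Set.Sum.elim_range, Submodule.span_union]

namespace IsPosLattice

theorem isOrtho_inf_ker_mulLeft (h : IsPosLattice S) (hU : U.IsHermitian) :
    S ⊓ LinearMap.ker (LinearMap.mulLeft ℝ U) ⟂
      S ⊓ LinearMap.ker (LinearMap.mulLeft ℝ (1 - U)) := by
  refine Submodule.isOrtho_iff_inner_eq.mpr fun X hX Y hY => ?_
  have hXU : X * U = 0 := mul_eq_zero_comm_of_isHermitian hU (h.isHermitian hX.1) hX.2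
  have hUY : Y = U * Y := by simpa [sub_mul, sub_eq_zero] using hY.2
  exact inner_eq_zero_of_mul_eq_zero (h.isHermitian hY.1) (by rw [hUY, ← mul_assoc, hXU, zero_mul])

theorem exists_orthonormal_posSemidef (h : IsPosLattice S) :
    ∃ (s : ℕ) (u : Fin s → CMat k), Orthonormal ℝ u ∧ (∀ i, (u i).PosSemidef) ∧
      Submodule.span ℝ (Set.range u) = S := by
  induction S using WellFoundedLT.induction with | _ S ih
  by_cases hbot : S = ⊥
  · exact ⟨0, Fin.elim0, ⟨Fin.rec0, fun i => i.elim0⟩, fun i => i.elim0, by simp [hbot]⟩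
  by_cases hS : ∀ P ∈ S, ∀ N ∈ S, P.PosSemidef → N.PosSemidef → P * N = 0 → P = 0 ∨ N = 0
  · obtain ⟨X, hX, hXpos, hX0⟩ := h.exists_posSemidef_ne_zero hbot
    have hspan : Submodule.span ℝ {X} = S :=
      le_antisymm (by simpa using hX) (h.le_span_singleton hS hX hXpos hX0)
    refine ⟨1, fun _ => ‖X‖⁻¹ • X, ?_, fun _ => hXpos.smul (by positivity), ?_⟩
    · exact orthonormal_subsingleton_iff.mpr fun _ => norm_smul_inv_norm hX0
    · rw [Set.range_const, Submodule.span_singleton_smul_eq (by simpa using hX0), hspan]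
  push Not at hS
  obtain ⟨P, hP, N, hN, hPpos, _, hPN, hP0, hN0⟩ := hS
  set U := supp P
  have hU : U.IsHermitian := isHermitian_supp P
  have hUS : ∀ Z ∈ S, Commute U Z := fun Z hZ => h.commute_supp hP hPpos hZ
  have hlt : S ⊓ LinearMap.ker (LinearMap.mulLeft ℝ U) < S :=
    inf_lt_left.mpr fun hle => hP0 ((supp_mul P).symm.trans (hle hP))
  have hlt' : S ⊓ LinearMap.ker (LinearMap.mulLeft ℝ (1 - U)) < S := inf_lt_left.mpr fun hle =>
    hN0 (by simpa [U, sub_mul, supp_mul_eq_zero hPpos.1 hPN] using hle hN)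
  have hsup : S ⊓ LinearMap.ker (LinearMap.mulLeft ℝ U) ⊔
      S ⊓ LinearMap.ker (LinearMap.mulLeft ℝ (1 - U)) = S :=
    sup_inf_ker_mulLeft (isStarProjection_supp P).1 fun Z hZ => h.supp_mul_mem hP hPpos hZ
  rw [← hsup]
  exact exists_orthonormal_append (h.isOrtho_inf_ker_mulLeft hU)
    (ih _ hlt (h.inf_ker_mulLeft hU hUS))
    (ih _ hlt' (h.inf_ker_mulLeft (isHermitian_one.sub hU)
      fun Z hZ => (Commute.one_left Z).sub_left (hUS Z hZ)))

end IsPosLattice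

end PosLattice

section SingularSpaceLattice

open Matrix
open scoped TraceInnerProduct

variable {k m : ℕ} {A : BiMat k m} {l : ℝ} {X Y P N : CMat k}

theorem inner_leftContraction_of_mem_singularSpace (hA : A.IsHermitian)
    (hX : X ∈ singularSpace A l) (hY : Y.IsHermitian) :
    inner ℝ (leftContraction A X) (leftContraction A Y) = l ^ 2 * inner ℝ X Y := by
  rw [← inner_rightContraction hA hY, hX.2, real_inner_smul_left]

theorem norm_leftContraction_of_mem_singularSpace (hA : A.IsHermitian) (hl : 0 ≤ l)
    (hX : X ∈ singularSpace A l) : ‖leftContraction A X‖ = l * ‖X‖ := by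
  rw [← sq_eq_sq₀ (norm_nonneg _) (by positivity), mul_pow, ← real_inner_self_eq_norm_sq,
    ← real_inner_self_eq_norm_sq, inner_leftContraction_of_mem_singularSpace hA hX hX.1]

theorem norm_sub_le_norm_add_of_inner_nonneg {E : Type*} [NormedAddCommGroup E]
    [InnerProductSpace ℝ E] {x y : E} (h : 0 ≤ inner ℝ x y) : ‖x - y‖ ≤ ‖x + y‖ := by
  rw [← sq_le_sq₀ (norm_nonneg _) (norm_nonneg _), norm_sub_sq_real, norm_add_sq_real]
  linarith

theorem add_mem_singularSpace (hA : A.PosSemidef) (hl : 0 ≤ l)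
    (hle : ∀ Y : CMat m, Y.IsHermitian → ‖rightContraction A Y‖ ≤ l * ‖Y‖) (hP : P.PosSemidef)
    (hN : N.PosSemidef) (hPN : P * N = 0) (h : P - N ∈ singularSpace A l) :
    P + N ∈ singularSpace A l := by
  have hherm : (P + N).IsHermitian := hP.1.add hN.1
  have hFherm := isHermitian_leftContraction hA.1 hherm
  have hnorm : ‖P + N‖ = ‖P - N‖ := by
    rw [add_comm, norm_sub_rev, norm_sub_eq_norm_add (inner_eq_zero_of_mul_eq_zero hN.1 hPN)]
  have hF : l * ‖P + N‖ ≤ ‖leftContraction A (P + N)‖ := by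
    rw [hnorm, ← norm_leftContraction_of_mem_singularSpace hA.1 hl h, map_sub, map_add]
    exact norm_sub_le_norm_add_of_inner_nonneg <| inner_nonneg_of_posSemidef
      (posSemidef_leftContraction hA hP) (posSemidef_leftContraction hA hN)
  refine ⟨hherm, eq_sq_smul_of_norm_le_mul (𝕜 := ℝ) hl ?_ (hle _ hFherm) hF⟩
  rw [RCLike.re_to_real, inner_rightContraction hA.1 hherm, real_inner_self_eq_norm_sq]

theorem isPosLattice_singularSpace (hA : A.PosSemidef) (hS : SplitsAlongSingularPairs A)
    (hl : 0 < l) (hle : ∀ Y : CMat m, Y.IsHermitian → ‖rightContraction A Y‖ ≤ l * ‖Y‖) :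
    IsPosLattice (singularSpace A l) where
  isHermitian _ hX := hX.1
  exists_sub X hX := by
    obtain ⟨P, N, hP, hN, rfl, hPN⟩ := exists_posSemidef_sub_posSemidef hX.1
    have hadd := add_mem_singularSpace hA hl.le hle hP hN hPN hX
    have hP' : P = (2⁻¹ : ℝ) • ((P + N) + (P - N)) := by module
    have hN' : N = (2⁻¹ : ℝ) • ((P + N) - (P - N)) := by module
    exact ⟨P, hP' ▸ Submodule.smul_mem _ _ (Submodule.add_mem _ hadd hX),
      N, hN' ▸ Submodule.smul_mem _ _ (Submodule.sub_mem _ hadd hX), hP, hN, rfl, hPN⟩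
  supp_mul_mem X Z hX hXpos hZ := by
    have hsplit : SplitsAlong A (supp X) (supp (l⁻¹ • leftContraction A X)) := by
      refine hS hl hXpos ((posSemidef_leftContraction hA hXpos).smul (by positivity))
        (smul_inv_smul₀ hl.ne' _).symm ?_
      rw [LinearMap.map_smul_of_tower, hX.2, smul_smul, sq, inv_mul_cancel_left₀ hl.ne']
    have hcomm : Commute (supp X) (l ^ 2 • Z) := hZ.2 ▸ hsplit.commute_rightContraction _
    exact hsplit.mul_mem_singularSpace (isHermitian_supp X)
      ((Commute.smul_right_iff₀ (pow_ne_zero 2 hl.ne')).mp hcomm) hZ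

end SingularSpaceLattice

section ExistenceSchmidt

open Matrix
open scoped TraceInnerProduct

variable {k m n : ℕ} {A : BiMat k m} {lam : Fin n → ℝ} {γ : Fin n → CMat k} {δ : Fin n → CMat m}

theorem exists_isHermitianSchmidt (hA : A.IsHermitian) :
    ∃ (n : ℕ) (lam : Fin n → ℝ) (γ : Fin n → CMat k) (δ : Fin n → CMat m),
      IsHermitianSchmidt A lam γ δ := by
  let T : selfAdjoint.submodule ℝ (CMat k) →ₗ[ℝ] selfAdjoint.submodule ℝ (CMat m) :=
    ((leftContraction A).restrictScalars ℝ).restrict fun _ hX => isHermitian_leftContraction hA hX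
  obtain ⟨n, σ, u, v, hσ, hu, hv, hT⟩ := exists_singularValueDecomposition T
  refine ⟨n, σ, fun i => u i, fun i => v i, isHermitianSchmidt_of_orthonormal hσ
    (fun i => (u i).2) (fun i => (v i).2) (hu.comp_linearIsometry (Submodule.subtypeₗᵢ _))
    (hv.comp_linearIsometry (Submodule.subtypeₗᵢ _)) ?_⟩
  refine eq_sum_smul_kronecker_of_leftContraction_eq (fun i => (u i).2) fun X hX => ?_
  exact (congrArg Subtype.val (hT ⟨X, hX⟩)).trans (by simp)

theorem exists_isHermitianSchmidt_sum_smul_kronecker_self (hlam : ∀ i, 0 ≤ lam i)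
    (hγ : ∀ i, (γ i).IsHermitian) :
    ∃ (n' : ℕ) (lam' : Fin n' → ℝ) (γ' : Fin n' → CMat k),
      IsHermitianSchmidt (∑ i, (lam i : ℂ) • (γ i ⊗ₖ γ i)) lam' γ' γ' := by
  obtain ⟨n', σ, u, hσ, hu, hTu⟩ := exists_orthonormal_sum_mul_inner_smul_eq (𝕜 := ℝ) hlam
    fun i => (⟨γ i, hγ i⟩ : selfAdjoint.submodule ℝ (CMat k))
  have huo := hu.comp_linearIsometry (Submodule.subtypeₗᵢ _)
  refine ⟨n', σ, fun i => u i, isHermitianSchmidt_of_orthonormal hσ (fun i => (u i).2)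
    (fun i => (u i).2) huo huo ?_⟩
  refine eq_sum_smul_kronecker_of_leftContraction_eq (fun i => (u i).2) fun X hX => ?_
  rw [leftContraction_sum_smul_kronecker hγ hX]
  simpa using congrArg Subtype.val (hTu ⟨X, hX⟩)

theorem IsSPC.compress {A : BiMat k k} {V : CMat k} (hV : V.IsHermitian) (hA : IsSPC A) :
    IsSPC (compress V V A) := by
  refine ⟨posSemidef_compress hV hV hA.1, ?_⟩
  obtain ⟨n, lam, γ, h⟩ := hA.2
  have hsum : _root_.compress V V A =
      ∑ i, (lam i : ℂ) • ((V * γ i * V) ⊗ₖ (V * γ i * V)) := by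
    simp only [_root_.compress, h.eq_sum, Finset.mul_sum, Finset.sum_mul, Matrix.mul_smul,
      Matrix.smul_mul, mul_kronecker_mul]
  rw [hsum]
  refine exists_isHermitianSchmidt_sum_smul_kronecker_self (fun i => (h.pos i).le) fun i => ?_
  rw [IsHermitian, conjTranspose_mul, conjTranspose_mul, (h.herm_left i).eq, hV.eq, mul_assoc]

namespace IsHermitianSchmidt

variable (h : IsHermitianSchmidt A lam γ δ)
include h

theorem comp_equiv (e : Fin n ≃ Fin n) : IsHermitianSchmidt A (lam ∘ e) (γ ∘ e) (δ ∘ e) :=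
  isHermitianSchmidt_of_orthonormal (fun _ => h.pos _) (fun _ => h.herm_left _)
    (fun _ => h.herm_right _) (h.orthonormal_fst.comp _ e.injective)
    (h.orthonormal_snd.comp _ e.injective)
    (h.eq_sum.trans (e.sum_comp fun i => (lam i : ℂ) • (γ i ⊗ₖ δ i)).symm)

theorem exists_antitone_comp : ∃ e : Fin n ≃ Fin n, Antitone (lam ∘ e) ∧
    IsHermitianSchmidt A (lam ∘ e) (γ ∘ e) (δ ∘ e) :=
  ⟨Tuple.sort (OrderDual.toDual ∘ lam), Tuple.monotone_sort (OrderDual.toDual ∘ lam),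
    h.comp_equiv _⟩

theorem norm_leftContraction_le {l : ℝ} (hl : 0 ≤ l) (hle : ∀ i, lam i ≤ l) {X : CMat k}
    (hX : X.IsHermitian) : ‖leftContraction A X‖ ≤ l * ‖X‖ := by
  rw [h.leftContraction_apply hX]
  exact norm_sum_mul_inner_smul_le h.orthonormal_fst h.orthonormal_snd
    (fun i => (abs_of_pos (h.pos i)).trans_le (hle i)) hl X

theorem norm_rightContraction_le {l : ℝ} (hl : 0 ≤ l) (hle : ∀ i, lam i ≤ l) {Y : CMat m}
    (hY : Y.IsHermitian) : ‖rightContraction A Y‖ ≤ l * ‖Y‖ :=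
  h.swap.norm_leftContraction_le hl hle hY

end IsHermitianSchmidt

end ExistenceSchmidt

section ExistenceSplitData

open Matrix
open scoped TraceInnerProduct

theorem exists_forall_val_lt_iff {n : ℕ} {p : Fin n → Prop} (hp : Antitone p) :
    ∃ s ≤ n, ∀ i : Fin n, (i : ℕ) < s ↔ p i := by
  classical
  have hex : ∃ s, ∀ i : Fin n, s ≤ (i : ℕ) → ¬p i := ⟨n, fun i hi => absurd i.2 hi.not_gt⟩
  refine ⟨Nat.find hex, Nat.find_min' hex fun i hi => absurd i.2 hi.not_gt, fun i => ⟨?_, ?_⟩⟩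
  · contrapose!
    exact fun hi => Nat.find_min' hex fun j hij hj => hi (hp hij hj)
  · contrapose!
    exact Nat.find_spec hex i

variable {k m n s : ℕ} {A : BiMat k m} {lam : Fin n → ℝ} {γ : Fin n → CMat k} {δ : Fin n → CMat m}
  {l : ℝ}

namespace IsHermitianSchmidt

variable (h : IsHermitianSchmidt A lam γ δ)
include h

theorem left_mem_singularSpace (i : Fin n) : γ i ∈ singularSpace A (lam i) :=
  ⟨h.herm_left i, by
    rw [h.leftContraction_left, LinearMap.map_smul_of_tower, h.rightContraction_right, smul_smul,
      sq]⟩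

theorem span_range_eq_singularSpace (hs : s ≤ n) (hl : 0 < l)
    (htop : ∀ i : Fin n, (i : ℕ) < s → lam i = l) (hgt : ∀ i : Fin n, s ≤ (i : ℕ) → lam i < l) :
    Submodule.span ℝ (Set.range (γ ∘ Fin.castLE hs)) = singularSpace A l := by
  refine le_antisymm (Submodule.span_le.mpr ?_) fun X hX => ?_
  · rintro _ ⟨i, rfl⟩
    exact htop (Fin.castLE hs i) i.2 ▸ h.left_mem_singularSpace _
  · rw [h.eq_sum_inner_smul_of_mem_singularSpace hs hl htop hgt hX]
    exact Submodule.sum_mem _ fun i _ => Submodule.smul_mem _ _ (Submodule.subset_span ⟨i, rfl⟩)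

theorem of_span_eq_singularSpace (hA : A.IsHermitian) (hs : s ≤ n) (hl : 0 < l)
    (htop : ∀ i : Fin n, (i : ℕ) < s → lam i = l) (hgt : ∀ i : Fin n, s ≤ (i : ℕ) → lam i < l)
    {u : Fin s → CMat k} (hu : Orthonormal ℝ u)
    (hspan : Submodule.span ℝ (Set.range u) = singularSpace A l) :
    IsHermitianSchmidt (∑ i ∈ Finset.univ.filter (fun i : Fin n => (i : ℕ) < s), γ i ⊗ₖ δ i)
      (fun _ : Fin s => (1 : ℝ)) u (fun j => l⁻¹ • leftContraction A (u j)) := by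
  have hmem : ∀ j, u j ∈ singularSpace A l := fun j => hspan ▸ Submodule.subset_span ⟨j, rfl⟩
  have huH : ∀ j, (u j).IsHermitian := fun j => (hmem j).1
  have hδ : Orthonormal ℝ fun j => l⁻¹ • leftContraction A (u j) := by
    refine orthonormal_iff_ite.mpr fun i j => ?_
    rw [real_inner_smul_left, real_inner_smul_right,
      inner_leftContraction_of_mem_singularSpace hA (hmem i) (huH j), ← mul_assoc, ← mul_assoc,
      orthonormal_iff_ite.mp hu]
    field_simp
  refine isHermitianSchmidt_of_orthonormal (fun _ => one_pos) huH
    (fun j => (isHermitian_leftContraction hA (huH j)).smul (.all _)) hu hδ ?_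
  refine eq_sum_smul_kronecker_of_leftContraction_eq huH fun X hX => ?_
  have hproj : ∑ j, inner ℝ (u j) X • u j =
      ∑ i, inner ℝ (γ (Fin.castLE hs i)) X • γ (Fin.castLE hs i) := by
    rw [sum_inner_smul_eq_starProjection hu hspan]
    exact (sum_inner_smul_eq_starProjection (h.orthonormal_fst.comp _ (Fin.castLE_injective hs))
      (h.span_range_eq_singularSpace hs hl htop hgt) X).symm
  have hF := congrArg (fun Z => l⁻¹ • leftContraction A Z) hproj
  simp only [map_sum, LinearMap.map_smul_of_tower, Finset.smul_sum, h.leftContraction_left] at hF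
  have hterm : ∀ i : Fin s, l⁻¹ • inner ℝ (γ (Fin.castLE hs i)) X •
      lam (Fin.castLE hs i) • δ (Fin.castLE hs i) =
        inner ℝ (γ (Fin.castLE hs i)) X • δ (Fin.castLE hs i) := fun i => by
    rw [htop (Fin.castLE hs i) i.2, smul_comm l⁻¹, inv_smul_smul₀ hl.ne']
  simp only [hterm] at hF
  rw [(h.initialSegment hs).leftContraction_apply hX]
  simpa only [one_mul, Function.comp_apply, smul_comm l⁻¹] using hF.symm

theorem exists_isSplitData (hanti : Antitone lam) (hA : A.PosSemidef)
    (hS : SplitsAlongSingularPairs A) (hA0 : A ≠ 0) :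
    ∃ (s : ℕ) (γ' : Fin s → CMat k) (δ' : Fin s → CMat m), IsSplitData A lam γ δ γ' δ' := by
  have hn : 0 < n := Nat.pos_of_ne_zero fun hn => by
    subst hn
    exact hA0 (by rw [h.eq_sum, Finset.univ_eq_empty, Finset.sum_empty])
  obtain ⟨l, hl⟩ : ∃ l, lam ⟨0, hn⟩ = l := ⟨_, rfl⟩
  have hlpos : 0 < l := hl ▸ h.pos _
  have hle : ∀ i, lam i ≤ l := fun i => hl ▸ hanti (Nat.zero_le i)
  obtain ⟨s, hsn, hs⟩ :=
    exists_forall_val_lt_iff (p := fun i => l ≤ lam i) fun i j hij hj => hj.trans (hanti hij)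
  have htop : ∀ i : Fin n, (i : ℕ) < s → lam i = l := fun i hi =>
    le_antisymm (hle i) ((hs i).mp hi)
  have hgt : ∀ i : Fin n, s ≤ (i : ℕ) → lam i < l := fun i hi =>
    not_le.mp fun hli => hi.not_gt ((hs i).mpr hli)
  obtain ⟨t, u, hu, hupos, hspan⟩ := (isPosLattice_singularSpace hA hS hlpos fun Y hY =>
    h.norm_rightContraction_le hlpos.le hle hY).exists_orthonormal_posSemidef
  obtain rfl : t = s := by
    have hγ := (h.orthonormal_fst.comp _ (Fin.castLE_injective hsn)).linearIndependent
    rw [← Fintype.card_fin t, ← finrank_span_eq_card hu.linearIndependent, hspan,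
      ← h.span_range_eq_singularSpace hsn hlpos htop hgt, finrank_span_eq_card hγ, Fintype.card_fin]
  exact ⟨t, u, _,
    { schmidt := h
      antitone := hanti
      one_le := (hs ⟨0, hn⟩).mpr hl.ge
      le := hsn
      top_eq := fun i j hi hj => (htop i hi).trans (htop j hj).symm
      top_gt := fun i j hi hj => (htop i hi).symm ▸ hgt j hj
      schmidt_top := h.of_span_eq_singularSpace hA.1 hsn hlpos htop hgt hu hspan
      posSemidef_left := hupos
      posSemidef_right := fun j =>
        (posSemidef_leftContraction hA (hupos j)).smul (inv_nonneg.mpr hlpos.le) }⟩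

end IsHermitianSchmidt

theorem exists_isSplitData (hA : A.PosSemidef) (hS : SplitsAlongSingularPairs A) (hA0 : A ≠ 0) :
    ∃ (n s : ℕ) (lam : Fin n → ℝ) (γ : Fin n → CMat k) (δ : Fin n → CMat m)
      (γ' : Fin s → CMat k) (δ' : Fin s → CMat m), IsSplitData A lam γ δ γ' δ' := by
  obtain ⟨n, lam, γ, δ, h⟩ := exists_isHermitianSchmidt hA.1
  obtain ⟨e, hanti, he⟩ := h.exists_antitone_comp
  obtain ⟨s, γ', δ', hsplit⟩ := he.exists_isSplitData hanti hA hS hA0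
  exact ⟨n, s, _, _, _, γ', δ', hsplit⟩

theorem IsSPC.exists_isSplitData {A : BiMat k k} (hA : IsSPC A) (hA0 : A ≠ 0) :
    ∃ (n s : ℕ) (lam : Fin n → ℝ) (γ : Fin n → CMat k) (γ' : Fin s → CMat k),
      IsSplitData A lam γ γ γ' γ' := by
  obtain ⟨n, lam, γ, h⟩ := hA.2
  obtain ⟨e, hanti, he⟩ := h.exists_antitone_comp
  obtain ⟨s, γ', δ', hsplit⟩ := he.exists_isSplitData hanti hA.1 hA.splitsAlongSingularPairs hA0
  obtain ⟨l, hl, htop, -⟩ := hsplit.exists_top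
  obtain rfl : γ' = δ' := funext fun j => hA.eq_of_singularPair (hsplit.posSemidef_left j).1
    (hsplit.posSemidef_right j).1 hl (hsplit.leftContraction_left htop j)
    (hsplit.rightContraction_right htop j)
  exact ⟨n, s, _, _, γ', hsplit⟩

end ExistenceSplitData

section IteratedSplit

open Matrix

variable {k m : ℕ} {A B : BiMat k m} {L : List (BiMat k m)}

namespace IteratedSplitPPT

theorem eq_sum (h : IteratedSplitPPT A L) (hS : SplitsAlongSingularPairs A) : A = L.sum := by
  induction h with
  | zero => rfl
  | step h _ ih =>
    rw [List.sum_append, List.sum_ofFn, ← ih (h.splitsAlongSingularPairs_splitRemainder hS)]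
    exact h.eq_sum_splitPiece_add_splitRemainder hS

theorem ne_zero_of_mem (h : IteratedSplitPPT A L) (hS : SplitsAlongSingularPairs A) (hB : B ∈ L) :
    B ≠ 0 := by
  induction h with
  | zero => exact absurd hB List.not_mem_nil
  | step h _ ih =>
    rcases List.mem_append.mp hB with hB | hB
    · obtain ⟨j, rfl⟩ := List.mem_ofFn.mp hB
      exact h.splitPiece_ne_zero hS j
    · exact ih (h.splitsAlongSingularPairs_splitRemainder hS) hB

theorem isWeakIrreducible_of_mem (h : IteratedSplitPPT A L) (hA : A.PosSemidef)
    (hS : SplitsAlongSingularPairs A) (hB : B ∈ L) : IsWeakIrreducible B := by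
  induction h with
  | zero => exact absurd hB List.not_mem_nil
  | step h _ ih =>
    rcases List.mem_append.mp hB with hB | hB
    · obtain ⟨j, rfl⟩ := List.mem_ofFn.mp hB
      exact h.isWeakIrreducible_splitPiece hA hS j
    · exact ih (posSemidef_compress (isStarProjection_complProj _).2
        (isStarProjection_complProj _).2 hA) (h.splitsAlongSingularPairs_splitRemainder hS) hB

theorem isPPT_of_mem (h : IteratedSplitPPT A L) (hA : IsPPT A) (hB : B ∈ L) : IsPPT B := by
  induction h with
  | zero => exact absurd hB List.not_mem_nil
  | step _ _ ih =>
    rcases List.mem_append.mp hB with hB | hB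
    · obtain ⟨j, rfl⟩ := List.mem_ofFn.mp hB
      exact hA.compress (isHermitian_supp _) (isHermitian_supp _)
    · exact ih (hA.compress (isStarProjection_complProj _).2 (isStarProjection_complProj _).2) hB

theorem isWeakIrreducible_or_two_le_length (h : IteratedSplitPPT A L) (hA : A.PosSemidef)
    (hS : SplitsAlongSingularPairs A) : IsWeakIrreducible A ∨ 2 ≤ L.length := by
  have hsum := h.eq_sum hS
  match L with
  | [] =>
    refine .inl ⟨hA, fun V₁ V₂ W₁ W₂ _ _ _ _ _ _ _ _ _ => .inl ?_⟩
    rw [hsum, List.sum_nil, compress, mul_zero, zero_mul]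
  | [B] =>
    rw [List.sum_singleton] at hsum
    exact .inl (hsum ▸ h.isWeakIrreducible_of_mem hA hS List.mem_cons_self)
  | _ :: _ :: L => exact .inr (by simp)

end IteratedSplitPPT

theorem IsPPT.exists_iteratedSplitPPT (hA : IsPPT A) : ∃ L, IteratedSplitPPT A L := by
  induction hK : LinearMap.ker (leftContraction A) using WellFoundedGT.induction generalizing A with
  | ind K ih =>
    subst hK
    rcases eq_or_ne A 0 with rfl | hA0
    · exact ⟨[], .zero⟩
    obtain ⟨n, s, lam, γ, δ, γ', δ', h⟩ := exists_isSplitData hA.1 hA.splitsAlongSingularPairs hA0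
    obtain ⟨L, hL⟩ := ih _ (h.ker_leftContraction_lt_ker_splitRemainder hA.splitsAlongSingularPairs)
      (hA.compress (isStarProjection_complProj _).2 (isStarProjection_complProj _).2) rfl
    exact ⟨_, .step h hL⟩

theorem IsSPC.exists_iteratedSplitSPC {A : BiMat k k} (hA : IsSPC A) :
    ∃ L, IteratedSplitSPC A L := by
  induction hK : LinearMap.ker (leftContraction A) using WellFoundedGT.induction generalizing A with
  | ind K ih =>
    subst hK
    rcases eq_or_ne A 0 with rfl | hA0
    · exact ⟨[], .zero⟩
    obtain ⟨n, s, lam, γ, γ', h⟩ := hA.exists_isSplitData hA0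
    obtain ⟨L, hL⟩ := ih _ (h.ker_leftContraction_lt_ker_splitRemainder hA.splitsAlongSingularPairs)
      (hA.compress (isStarProjection_complProj _).2) rfl
    exact ⟨_, .step h hL⟩

namespace IteratedSplitSPC

variable {A B : BiMat k k} {L : List (BiMat k k)}

theorem iteratedSplitPPT (h : IteratedSplitSPC A L) : IteratedSplitPPT A L := by
  induction h with
  | zero => exact .zero
  | step h _ ih => exact .step h ih

theorem isSPC_of_mem (h : IteratedSplitSPC A L) (hA : IsSPC A) (hB : B ∈ L) : IsSPC B := by
  induction h with
  | zero => exact absurd hB List.not_mem_nil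
  | step _ _ ih =>
    rcases List.mem_append.mp hB with hB | hB
    · obtain ⟨j, rfl⟩ := List.mem_ofFn.mp hB
      exact hA.compress (isHermitian_supp _)
    · exact ih (hA.compress (isStarProjection_complProj _).2) hB

end IteratedSplitSPC

end IteratedSplit

theorem mainTheorem4 :
    (∀ (k : ℕ) (A : BiMat k k), IsSPC A →
      (∃ L : List (BiMat k k), IteratedSplitSPC A L) ∧
      ∀ L : List (BiMat k k), IteratedSplitSPC A L →
        A = L.sum ∧
        (∀ B ∈ L, B ≠ 0 ∧ IsSPC B ∧ IsWeakIrreducible B) ∧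
        (IsWeakIrreducible A ∨ 2 ≤ L.length)) ∧
    (∀ (k m : ℕ) (A : BiMat k m), IsPPT A →
      (∃ L : List (BiMat k m), IteratedSplitPPT A L) ∧
      ∀ L : List (BiMat k m), IteratedSplitPPT A L →
        A = L.sum ∧
        (∀ B ∈ L, B ≠ 0 ∧ IsPPT B ∧ IsWeakIrreducible B) ∧
        (IsWeakIrreducible A ∨ 2 ≤ L.length)) := by
  refine ⟨fun k A hA => ⟨hA.exists_iteratedSplitSPC, fun L hL => ?_⟩,
    fun k m A hA => ⟨hA.exists_iteratedSplitPPT, fun L hL => ?_⟩⟩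
  · have hS := hA.splitsAlongSingularPairs
    have hL' := hL.iteratedSplitPPT
    exact ⟨hL'.eq_sum hS, fun B hB => ⟨hL'.ne_zero_of_mem hS hB, hL.isSPC_of_mem hA hB,
      hL'.isWeakIrreducible_of_mem hA.1 hS hB⟩, hL'.isWeakIrreducible_or_two_le_length hA.1 hS⟩
  · have hS := hA.splitsAlongSingularPairs
    exact ⟨hL.eq_sum hS, fun B hB => ⟨hL.ne_zero_of_mem hS hB, hL.isPPT_of_mem hA hB,
      hL.isWeakIrreducible_of_mem hA.1 hS hB⟩, hL.isWeakIrreducible_or_two_le_length hA.1 hS⟩
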